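/- For a link $L\subset S^3$ let $Q_L(x)\in\mathbb{Z}[x,x^{-1}]$ denote its $Q$-polynomial (the Brandt–Lickorish–Millett polynomial, i.e. the Kauffman polynomial $F_L(a,x)$ at $a=1$). It is the isotopy invariant of unoriented links determined by $Q_{\mathrm{unknot}}=1$ and $$Q_{L_+}+Q_{L_-}=x\,(Q_{L_0}+Q_{L_\infty}),$$ where $L_+,L_-,L_0,L_\infty$ are links with diagrams that are identical except near one point, where $L_\pm$ have the two possible crossings and $L_0,L_\infty$ the two smoothings of the crossing. For integers $p,q$ let $K(p,q)$ be the Kanenobu knot with $p$ and $q$ half twists, which has the following diagram with $|p|+|q|+8$ crossings. Let $s_i$ be the crossing of the strands at positions $i,i+1$ (of six vertical strands numbered $0,\dots,5$) in which the strand going from lower left to upper right is on top, and let $s_i^{-1}$ be the opposite crossing. Read from bottom to top, the diagram consists of three minima joining the strands $01$, $23$, $45$, the braid $$s_1\,s_3^{-1}\,s_0^{-1}\,s_4\cdot s_2^{-q}\cdot s_1\,s_3^{-1}\cdot s_2^{-p}\cdot s_1\,s_3^{-1},$$ and three maxima joining the strands $01$, $23$, $45$. Then, for all integers $p,q$, the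 $Q$-polynomial $Q(p,q)$ of $K(p,q)$ is a polynomial in $x$ (without negative powers), and $$\deg Q(p,q)=\begin{cases}|p|+|q|+6,&\text{if } pq\ge 0,\\ |p|+|q|+5,&\text{if } pq<0.\end{cases}$$ -/

import Mathlib

/-! # Link diagrams as words of elementary tangles, the `Q`-polynomial, Kanenobu knots

An unoriented link diagram in general position with respect to a height function is cut by
horizontal lines into layers, each of which contains exactly one local minimum (cup), local maximum
(cap) or crossing, and otherwise only vertical strands. The word of these layers, read upwards,
determines the diagram up to planar isotopy preserving the height order of the layers. -/

/-- The elementary tangles. In `crossOver` the strand running from the lower left to the upper right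
passes over the other one; in `crossUnder` it passes under it. -/
inductive TangleGen : Type
  | cup
  | cap
  | crossOver
  | crossUnder
  deriving DecidableEq

namespace TangleGen

/-- The number of strands entering from below. -/
def src : TangleGen → ℕ
  | cup => 0
  | cap => 2
  | crossOver => 2
  | crossUnder => 2

/-- The number of strands leaving at the top. -/
def tgt : TangleGen → ℕ
  | cup => 2
  | cap => 0
  | crossOver => 2
  | crossUnder => 2

end TangleGen

/-- An elementary tangle with `pos` vertical strands to its left (and any number of vertical
strands to its right). -/
structure Layer : Type where
  gen : TangleGen
  pos : ℕ
  deriving DecidableEq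

/-- A local minimum, inserting new strands at the positions `i`, `i + 1`. -/
abbrev cupAt (i : ℕ) : Layer := ⟨TangleGen.cup, i⟩

/-- A local maximum, joining the strands at the positions `i`, `i + 1`. -/
abbrev capAt (i : ℕ) : Layer := ⟨TangleGen.cap, i⟩

/-- A crossing of the strands at the positions `i`, `i + 1`, with the strand going from `i` to
`i + 1` on top. -/
abbrev overAt (i : ℕ) : Layer := ⟨TangleGen.crossOver, i⟩

/-- A crossing of the strands at the positions `i`, `i + 1`, with the strand going from `i + 1`
to `i` on top. -/
abbrev underAt (i : ℕ) : Layer := ⟨TangleGen.crossUnder, i⟩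

/-- The number of strands above a layer that has `n` strands below it, if the layer fits. -/
def Layer.width (l : Layer) (n : ℕ) : Option ℕ :=
  if l.pos + l.gen.src ≤ n then some (n - l.gen.src + l.gen.tgt) else none

/-- The number of strands above a word of layers (read upwards) that has `n` strands below it, if
the layers fit on each other. -/
def wordWidth : List Layer → ℕ → Option ℕ
  | [], n => some n
  | l :: w, n => (l.width n).bind (wordWidth w)

/-- Unoriented link diagrams: words of layers with no strand at the bottom and at the top. -/
def LinkDiagram : Type := {w : List Layer // wordWidth w 0 = some 0}

/-- The local moves on words of layers that generate isotopy of unoriented links: planar isotopies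
(change of height of distant layers, straightening of a zigzag, sliding a strand past a local
extremum at a crossing) and the Reidemeister moves of types I, II and III. -/
inductive LocalMove : List Layer → List Layer → Prop
  | exchange (g h : TangleGen) (i k : ℕ) :
      LocalMove [⟨g, i⟩, ⟨h, i + g.tgt + k⟩] [⟨h, i + g.src + k⟩, ⟨g, i⟩]
  | zigzag (i : ℕ) : LocalMove [cupAt (i + 1), capAt i] []
  | zagzig (i : ℕ) : LocalMove [cupAt i, capAt (i + 1)] []
  | overCap (i : ℕ) : LocalMove [overAt i, capAt (i + 1)] [underAt (i + 1), capAt i]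
  | underCap (i : ℕ) : LocalMove [underAt i, capAt (i + 1)] [overAt (i + 1), capAt i]
  | cupOver (i : ℕ) : LocalMove [cupAt (i + 1), overAt i] [cupAt i, underAt (i + 1)]
  | cupUnder (i : ℕ) : LocalMove [cupAt (i + 1), underAt i] [cupAt i, overAt (i + 1)]
  | reidemeisterOneOverCap (i : ℕ) : LocalMove [overAt i, capAt i] [capAt i]
  | reidemeisterOneUnderCap (i : ℕ) : LocalMove [underAt i, capAt i] [capAt i]
  | reidemeisterOneCupOver (i : ℕ) : LocalMove [cupAt i, overAt i] [cupAt i]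
  | reidemeisterOneCupUnder (i : ℕ) : LocalMove [cupAt i, underAt i] [cupAt i]
  | reidemeisterTwo (i : ℕ) : LocalMove [overAt i, underAt i] []
  | reidemeisterTwo' (i : ℕ) : LocalMove [underAt i, overAt i] []
  | reidemeisterThree (i : ℕ) :
      LocalMove [overAt i, overAt (i + 1), overAt i] [overAt (i + 1), overAt i, overAt (i + 1)]

/-- `D'` arises from `D` by one local move inside a larger diagram. -/
def IsotopyStep (D D' : LinkDiagram) : Prop :=
  ∃ u a b v : List Layer, LocalMove a b ∧ D.1 = u ++ a ++ v ∧ D'.1 = u ++ b ++ v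

/-- Unoriented links up to isotopy: diagrams modulo the equivalence relation generated by the local
moves. -/
def Link : Type := Quot IsotopyStep

/-- The link of a diagram. -/
def LinkDiagram.toLink (D : LinkDiagram) : Link := Quot.mk IsotopyStep D

/-- The unknot, as a circle without crossings. -/
def unknot : Link := LinkDiagram.toLink ⟨[cupAt 0, capAt 0], by decide⟩

/-- The skein relations `L₊ + L₋ - x (L₀ + L_∞)` of the `Q`-polynomial, in the free
`ℤ[x, x⁻¹]`-module on all links. The four diagrams are identical except at one crossing, which is
of one kind in `D₊`, of the other kind in `D₋`, and is replaced by its two smoothings in `D₀` and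
`D_∞`. -/
def skeinRelators : Set (Link →₀ LaurentPolynomial ℤ) :=
  {r | ∃ (Dp Dm D0 Dinf : LinkDiagram) (u v : List Layer) (i : ℕ),
    Dp.1 = u ++ [overAt i] ++ v ∧ Dm.1 = u ++ [underAt i] ++ v ∧
    D0.1 = u ++ v ∧ Dinf.1 = u ++ [capAt i, cupAt i] ++ v ∧
    r = Finsupp.single Dp.toLink 1 + Finsupp.single Dm.toLink 1
      - (LaurentPolynomial.T 1 : LaurentPolynomial ℤ) •
        (Finsupp.single D0.toLink 1 + Finsupp.single Dinf.toLink 1)}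

/-- The skein relations and the normalization `Q(unknot) = 1` force the value `f` on the link `L`:
modulo the skein relations, `L` equals `f` times the unknot. -/
def HasQPolynomial (L : Link) (f : LaurentPolynomial ℤ) : Prop :=
  Finsupp.single L 1 - Finsupp.single unknot f ∈
    Submodule.span (LaurentPolynomial ℤ) skeinRelators

open Classical in
/-- The `Q`-polynomial of an unoriented link, in `ℤ[x, x⁻¹]` with `x = T 1`: the unique Laurent
polynomial forced by `Q(unknot) = 1` and `Q(L₊) + Q(L₋) = x (Q(L₀) + Q(L_∞))`. (If there were none
or several, the value would be `0` by convention.) -/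
noncomputable def qPolynomial (L : Link) : LaurentPolynomial ℤ :=
  if h : ∃! f : LaurentPolynomial ℤ, HasQPolynomial L f then h.choose else 0

/-- A column of `|n|` half twists of the strands at the positions `i`, `i + 1`. The sign is such
that, for strands running in opposite directions, positive `n` gives positive crossings. -/
def halfTwists (i : ℕ) (n : ℤ) : List Layer :=
  List.replicate n.natAbs (if 0 ≤ n then underAt i else overAt i)

/-- The standard diagram with `|p| + |q| + 8` crossings of the Kanenobu knot `K(p, q)`, drawn
symmetrically about a vertical axis between the positions `2` and `3`: a figure eight knot with four
crossings to the left of the axis, its mirror image to the right, joined at the top and bottom, and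
two columns of `p` and `q` half twists on the axis. -/
def kanenobuWord (p q : ℤ) : List Layer :=
  [cupAt 0, cupAt 2, cupAt 4, overAt 1, underAt 3, underAt 0, overAt 4] ++ halfTwists 2 q ++
    [overAt 1, underAt 3] ++ halfTwists 2 p ++
    [overAt 1, underAt 3, capAt 4, capAt 2, capAt 0]

theorem wordWidth_append (u v : List Layer) (n : ℕ) :
    wordWidth (u ++ v) n = (wordWidth u n).bind (wordWidth v) := by
  induction u generalizing n with
  | nil => rfl
  | cons l u ih =>
    simp only [List.cons_append, wordWidth]
    cases l.width n with
    | none => rfl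
    | some m => exact ih m

theorem wordWidth_halfTwists (i n : ℕ) (hi : i + 2 ≤ n) (m : ℤ) :
    wordWidth (halfTwists i m) n = some n := by
  unfold halfTwists
  induction m.natAbs with
  | zero => rfl
  | succ k ih =>
    have hw : (if 0 ≤ m then underAt i else overAt i).width n = some n := by
      have h2 : n - 2 + 2 = n := by omega
      split_ifs <;> simp [Layer.width, TangleGen.src, TangleGen.tgt, hi, h2]
    rw [List.replicate_succ, wordWidth, hw]
    exact ih

theorem wordWidth_kanenobuWord (p q : ℤ) : wordWidth (kanenobuWord p q) 0 = some 0 := by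
  have h1 : wordWidth [cupAt 0, cupAt 2, cupAt 4, overAt 1, underAt 3, underAt 0, overAt 4] 0
      = some 6 := by decide
  have h2 : wordWidth [overAt 1, underAt 3] 6 = some 6 := by decide
  have h3 : wordWidth [overAt 1, underAt 3, capAt 4, capAt 2, capAt 0] 6 = some 0 := by decide
  unfold kanenobuWord
  simp only [wordWidth_append, h1, h2, h3, Option.bind_some,
    wordWidth_halfTwists 2 6 (by norm_num)]

/-- The Kanenobu knot `K(p, q)`. -/
def kanenobuKnot (p q : ℤ) : Link :=
  LinkDiagram.toLink ⟨kanenobuWord p q, wordWidth_kanenobuWord p q⟩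

/-! # The degree of the `Q`-polynomial of Kanenobu knots -/

/-! In the module of links modulo the skein relations, having `Q`-polynomial `f` means being equal
to `f` times the unknot. Two facts are needed: `K(p, q)` is an explicit multiple of the unknot
(`hasQPolynomial_kanenobuKnot`), and the multiplier is unique (`HasQPolynomial.unique`).

Existence. Replacing a crossing in either column of half twists by a maximum below a minimum gives
the unlink with two components, whatever the other column contains. Its value is `δ = 2/x - 1`, so
`Q(p+1,q) + Q(p-1,q) = x (Q(p,q) + δ)`, and likewise in `q`. As `xδ = 2 - x`, the difference `Q - 1`
satisfies the homogeneous Chebyshev recursion `u(n+1) + u(n-1) = x u(n)` in both variables. It is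
therefore determined by its values for `p, q` in `{0, 1}`. These are computed in a family of 15
tangles with six endpoints, and have the form `2A`, `xA`, `xA`, `B` with `deg A = 6` and `deg B =
8`.

Degree. If two consecutive terms of such a sequence do not drop in degree, the degree grows by one
at every later step. The value at `(1, -1)` is `x²A - B`, where the terms `2x⁸` cancel and degree 7
remains. This is the loss of one for `pq < 0` (`natDegree_kanenobuPoly`).

Uniqueness. Solutions of the Yang-Baxter equation of orthogonal type with `2n + 1` colours give
state sums that satisfy the skein relation at special values of `x` and do not vanish on the unknot
(`exists_evaluation`). Two candidates for `Q` thus agree at infinitely many points. -/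

section SkeinCalculus

open LaurentPolynomial
open scoped LaurentPolynomial

/-! ## The skein module and tangles as linear maps -/

/-- The module of links modulo the skein relations. -/
abbrev SkeinModule : Type :=
  (Link →₀ LaurentPolynomial ℤ) ⧸ Submodule.span (LaurentPolynomial ℤ) skeinRelators

/-- The class of a link in the skein module. -/
noncomputable def Link.skein (L : Link) : SkeinModule :=
  Submodule.Quotient.mk (Finsupp.single L 1)

theorem Layer.width_eq_some_iff {l : Layer} {n m : ℕ} :
    l.width n = some m ↔ l.pos + l.gen.src ≤ n ∧ n - l.gen.src + l.gen.tgt = m := by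
  unfold Layer.width
  split_ifs with h <;> simp [h]

open Classical in
/-- The class of the closed diagram given by a word, and `0` for all other words. -/
noncomputable def wordSkein (w : List Layer) : SkeinModule :=
  if h : wordWidth w 0 = some 0 then Link.skein (LinkDiagram.toLink ⟨w, h⟩) else 0

theorem wordSkein_of_width {w : List Layer} (h : wordWidth w 0 = some 0) :
    wordSkein w = Link.skein (LinkDiagram.toLink ⟨w, h⟩) := dif_pos h

theorem hasQPolynomial_iff (L : Link) (f : LaurentPolynomial ℤ) :
    HasQPolynomial L f ↔ L.skein = f • unknot.skein := by
  unfold HasQPolynomial Link.skein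
  rw [← Submodule.Quotient.mk_smul, Finsupp.smul_single, smul_eq_mul, mul_one,
    Submodule.Quotient.eq]

theorem wordSkein_move {u a b v : List Layer} (hab : LocalMove a b)
    (ha : wordWidth (u ++ a ++ v) 0 = some 0) (hb : wordWidth (u ++ b ++ v) 0 = some 0) :
    wordSkein (u ++ a ++ v) = wordSkein (u ++ b ++ v) := by
  rw [wordSkein_of_width ha, wordSkein_of_width hb]
  congr 1
  exact Quot.sound ⟨u, a, b, v, hab, rfl, rfl⟩

theorem wordSkein_skein {u v : List Layer} {i : ℕ}
    (hp : wordWidth (u ++ [overAt i] ++ v) 0 = some 0)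
    (hm : wordWidth (u ++ [underAt i] ++ v) 0 = some 0)
    (h0 : wordWidth (u ++ v) 0 = some 0)
    (hi : wordWidth (u ++ [capAt i, cupAt i] ++ v) 0 = some 0) :
    wordSkein (u ++ [overAt i] ++ v) + wordSkein (u ++ [underAt i] ++ v) =
      (T 1 : LaurentPolynomial ℤ) •
        (wordSkein (u ++ v) + wordSkein (u ++ [capAt i, cupAt i] ++ v)) := by
  rw [wordSkein_of_width hp, wordSkein_of_width hm, wordSkein_of_width h0, wordSkein_of_width hi]
  unfold Link.skein
  rw [← Submodule.Quotient.mk_add, ← Submodule.Quotient.mk_add, ← Submodule.Quotient.mk_smul,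
    Submodule.Quotient.eq]
  exact Submodule.subset_span ⟨⟨_, hp⟩, ⟨_, hm⟩, ⟨_, h0⟩, ⟨_, hi⟩, u, v, i, rfl, rfl, rfl, rfl, rfl⟩

/-- Functionals on upward continuations of tangles with `n` upper endpoints that respect the local
moves and the skein relation. A tangle with `n` endpoints, all of them at the top, gives the
functional that maps a continuation to the class of the completed diagram. -/
def Ket (n : ℕ) : Submodule (LaurentPolynomial ℤ) (List Layer → SkeinModule) where
  carrier := {k |
    (∀ v, wordWidth v n ≠ some 0 → k v = 0) ∧
    (∀ u a b v, LocalMove a b → wordWidth (u ++ a ++ v) n = some 0 →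
      wordWidth (u ++ b ++ v) n = some 0 → k (u ++ a ++ v) = k (u ++ b ++ v)) ∧
    ∀ u v i m, wordWidth u n = some m → i + 2 ≤ m → wordWidth v m = some 0 →
      k (u ++ [overAt i] ++ v) + k (u ++ [underAt i] ++ v) =
        (T 1 : LaurentPolynomial ℤ) • (k (u ++ v) + k (u ++ [capAt i, cupAt i] ++ v))}
  zero_mem' := ⟨fun _ _ => rfl, fun _ _ _ _ _ _ _ => rfl, fun _ _ _ _ _ _ _ => by simp⟩
  add_mem' := by
    rintro k l ⟨h1, h2, h3⟩ ⟨g1, g2, g3⟩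
    refine ⟨fun v hv => ?_, fun u a b v hab ha hb => ?_, fun u v i m hu hi hv => ?_⟩
    · simp [h1 v hv, g1 v hv]
    · simp only [Pi.add_apply, h2 u a b v hab ha hb, g2 u a b v hab ha hb]
    · have h := h3 u v i m hu hi hv
      have g := g3 u v i m hu hi hv
      simp only [Pi.add_apply]
      rw [add_add_add_comm, h, g, ← smul_add, add_add_add_comm]
  smul_mem' := by
    rintro c k ⟨h1, h2, h3⟩
    refine ⟨fun v hv => ?_, fun u a b v hab ha hb => ?_, fun u v i m hu hi hv => ?_⟩
    · simp [h1 v hv]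
    · simp only [Pi.smul_apply, h2 u a b v hab ha hb]
    · have h := h3 u v i m hu hi hv
      simp only [Pi.smul_apply]
      rw [← smul_add, h, ← smul_add, smul_comm]

namespace Ket

/-- Adding a layer to a tangle. -/
noncomputable def actAux (l : Layer) (n m : ℕ) (h : ∀ m', l.width n = some m' → m' = m) :
    Ket n →ₗ[LaurentPolynomial ℤ] Ket m :=
  LinearMap.restrict (LinearMap.funLeft (LaurentPolynomial ℤ) SkeinModule (List.cons l)) <| by
    rintro k ⟨h1, h2, h3⟩
    have hw : ∀ v, wordWidth v m = some 0 → l.width n = some m →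
        wordWidth (l :: v) n = some 0 := by
      intro v hv hl
      simp [wordWidth, hl, hv]
    by_cases hl : l.width n = some m
    · refine ⟨fun v hv => ?_, fun u a b v hab ha hb => ?_, fun u v i m' hu hi hv => ?_⟩
      · refine h1 _ ?_
        simpa [wordWidth, hl] using hv
      · refine h2 (l :: u) a b v hab ?_ ?_
        · simpa using hw _ ha hl
        · simpa using hw _ hb hl
      · refine h3 (l :: u) v i m' ?_ hi hv
        simp [wordWidth, hl, hu]
    -- A layer that does not fit acts as zero, so the operators below exist at every position
    -- without side conditions.
    · have hn : l.width n = none := by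
        cases h' : l.width n with
        | none => rfl
        | some m' => exact absurd (by rw [h', h m' h']) hl
      have hk : LinearMap.funLeft (LaurentPolynomial ℤ) SkeinModule (List.cons l) k = 0 := by
        funext v
        refine h1 _ ?_
        simp [wordWidth, hn]
      rw [hk]
      exact Submodule.zero_mem _

variable {n : ℕ}

/-- Adding a local minimum. -/
noncomputable def cup (i : ℕ) : Ket n →ₗ[LaurentPolynomial ℤ] Ket (n + 2) :=
  actAux (cupAt i) n (n + 2) (by
    simp only [Layer.width, TangleGen.src, TangleGen.tgt]
    split_ifs <;> simp)

/-- Adding a local maximum. -/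
noncomputable def cap (i : ℕ) : Ket (n + 2) →ₗ[LaurentPolynomial ℤ] Ket n :=
  actAux (capAt i) (n + 2) n (by
    simp only [Layer.width, TangleGen.src, TangleGen.tgt]
    split_ifs <;> simp)

/-- Adding a crossing `overAt i`. -/
noncomputable def overX (i : ℕ) : Ket n →ₗ[LaurentPolynomial ℤ] Ket n :=
  actAux (overAt i) n n (by
    intro m h
    simp only [Layer.width_eq_some_iff, TangleGen.src, TangleGen.tgt] at h
    omega)

/-- Adding a crossing `underAt i`. -/
noncomputable def underX (i : ℕ) : Ket n →ₗ[LaurentPolynomial ℤ] Ket n :=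
  actAux (underAt i) n n (by
    intro m h
    simp only [Layer.width_eq_some_iff, TangleGen.src, TangleGen.tgt] at h
    omega)

theorem ext_apply {k l : Ket n} (h : ∀ v, k.1 v = l.1 v) : k = l := Subtype.ext (funext h)

/-- A move such as the cancellation of a zigzag can turn a word that does not fit into one that
fits. Equal widths ensure that both sides vanish together when the continuation does not close up.
-/
theorem apply_move (k : Ket n) {a b : List Layer} (hab : LocalMove a b)
    (hw : wordWidth a n = wordWidth b n) (v : List Layer) : k.1 (a ++ v) = k.1 (b ++ v) := by
  obtain ⟨k, h1, h2, h3⟩ := k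
  have hwv : wordWidth (a ++ v) n = wordWidth (b ++ v) n := by
    rw [wordWidth_append, wordWidth_append, hw]
  by_cases ha : wordWidth (a ++ v) n = some 0
  · exact h2 [] a b v hab ha (hwv ▸ ha)
  · exact (h1 _ ha).trans (h1 _ (hwv ▸ ha)).symm

theorem exchange_width (g h : TangleGen) (i k : ℕ) :
    wordWidth [⟨g, i⟩, ⟨h, i + g.tgt + k⟩] n = wordWidth [⟨h, i + g.src + k⟩, ⟨g, i⟩] n := by
  have hg : g.tgt ≤ g.src + 2 := by cases g <;> decide
  simp only [wordWidth, Layer.width]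
  by_cases h1 : i + g.src + k + h.src ≤ n
  · have h2 : i + g.src ≤ n := by omega
    have h3 : i + g.tgt + k + h.src ≤ n - g.src + g.tgt := by omega
    have h4 : i + g.src ≤ n - h.src + h.tgt := by omega
    simp only [h1, h2, h3, h4, if_true, Option.bind_some]
    congr 1
    omega
  · by_cases h2 : i + g.src ≤ n
    · have h3 : ¬ i + g.tgt + k + h.src ≤ n - g.src + g.tgt := by omega
      simp [h1, h2, h3]
    · simp [h1, h2]

/-- The positions are tied by conditions instead of being written as sums, which lets the lemma
apply to arbitrary positions `j`, `j'`. -/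
theorem apply_exchange (k : Ket n) (g h : TangleGen) {i j j' : ℕ} (hj : i + g.src ≤ j)
    (hj' : j' + g.src = j + g.tgt) (v : List Layer) :
    k.1 (⟨g, i⟩ :: ⟨h, j'⟩ :: v) = k.1 (⟨h, j⟩ :: ⟨g, i⟩ :: v) := by
  obtain ⟨d, rfl⟩ := Nat.exists_eq_add_of_le hj
  obtain rfl : j' = i + g.tgt + d := by omega
  exact apply_move k (.exchange g h i d) (exchange_width g h i d) v

variable {i j : ℕ}

/-! ### Isotopy and skein relations between elementary tangles. -/

theorem cup_cup (k : Ket n) (h : i ≤ j) : cup (j + 2) (cup i k) = cup i (cup j k) :=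
  (ext_apply fun v => apply_exchange k .cup .cup (by simpa only [TangleGen.src,
      Nat.add_le_add_iff_right])
    (by simp only [TangleGen.src, TangleGen.tgt]) v)

theorem cap_cap (k : Ket (n + 2 + 2)) (h : i ≤ j) : cap j (cap i k) = cap i (cap (j + 2) k) :=
  (ext_apply fun v => apply_exchange k .cap .cap (by simpa only [TangleGen.src,
      Nat.add_le_add_iff_right])
    (by simp only [TangleGen.src, TangleGen.tgt]) v)

theorem cap_cup_right (k : Ket (n + 2)) (h : i ≤ j) : cap (j + 2) (cup i k) = cup i (cap j k) :=
  (ext_apply fun v => apply_exchange k .cup .cap (by simpa only [TangleGen.src,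
      Nat.add_le_add_iff_right])
    (by simp only [TangleGen.src, TangleGen.tgt]) v)

theorem cap_cup_left (k : Ket (n + 2)) (h : i ≤ j) : cap i (cup (j + 2) k) = cup j (cap i k) :=
  (ext_apply fun v => apply_exchange k .cap .cup (by simpa only [TangleGen.src,
      Nat.add_le_add_iff_right])
    (by simp only [TangleGen.src, TangleGen.tgt]) v).symm

theorem overX_cup_right (k : Ket n) (h : i ≤ j) : overX (j + 2) (cup i k) = cup i (overX j k) :=
  (ext_apply fun v => apply_exchange k .cup .crossOver (by simpa only [TangleGen.src,
      Nat.add_le_add_iff_right])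
    (by simp only [TangleGen.src, TangleGen.tgt]) v)

theorem overX_cup_left (k : Ket n) (h : i + 2 ≤ j) : overX i (cup j k) = cup j (overX i k) :=
  (ext_apply fun v => apply_exchange k .crossOver .cup (by simpa only [TangleGen.src,
      Nat.add_le_add_iff_right])
    (by simp only [TangleGen.src, TangleGen.tgt]) v).symm

theorem cap_overX_right (k : Ket (n + 2)) (h : i ≤ j) : cap i (overX (j + 2) k) = overX j (cap i k)
    :=
  (ext_apply fun v => apply_exchange k .cap .crossOver (by simpa only [TangleGen.src,
      Nat.add_le_add_iff_right])
    (by simp only [TangleGen.src, TangleGen.tgt]) v).symm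

theorem cap_overX_left (k : Ket (n + 2)) (h : i + 2 ≤ j) : cap j (overX i k) = overX i (cap j k) :=
  (ext_apply fun v => apply_exchange k .crossOver .cap (by simpa only [TangleGen.src,
      Nat.add_le_add_iff_right])
    (by simp only [TangleGen.src, TangleGen.tgt]) v)

theorem underX_cup_right (k : Ket n) (h : i ≤ j) : underX (j + 2) (cup i k) = cup i (underX j k) :=
  (ext_apply fun v => apply_exchange k .cup .crossUnder (by simpa only [TangleGen.src,
      Nat.add_le_add_iff_right])
    (by simp only [TangleGen.src, TangleGen.tgt]) v)

theorem underX_cup_left (k : Ket n) (h : i + 2 ≤ j) : underX i (cup j k) = cup j (underX i k) :=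
  (ext_apply fun v => apply_exchange k .crossUnder .cup (by simpa only [TangleGen.src,
      Nat.add_le_add_iff_right])
    (by simp only [TangleGen.src, TangleGen.tgt]) v).symm

theorem cap_underX_right (k : Ket (n + 2)) (h : i ≤ j) : cap i (underX (j + 2) k) = underX j (cap i
    k) :=
  (ext_apply fun v => apply_exchange k .cap .crossUnder (by simpa only [TangleGen.src,
      Nat.add_le_add_iff_right])
    (by simp only [TangleGen.src, TangleGen.tgt]) v).symm

theorem cap_underX_left (k : Ket (n + 2)) (h : i + 2 ≤ j) : cap j (underX i k) = underX i (cap j k)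
    :=
  (ext_apply fun v => apply_exchange k .crossUnder .cap (by simpa only [TangleGen.src,
      Nat.add_le_add_iff_right])
    (by simp only [TangleGen.src, TangleGen.tgt]) v)

theorem underX_overX_comm (k : Ket n) (h : i + 2 ≤ j) : underX j (overX i k) = overX i (underX j k)
    :=
  (ext_apply fun v => apply_exchange k .crossOver .crossUnder (by simpa only [TangleGen.src,
      Nat.add_le_add_iff_right])
    (by simp only [TangleGen.src, TangleGen.tgt]) v)

theorem underX_underX_comm (k : Ket n) (h : i + 2 ≤ j) : underX j (underX i k) = underX i (underX j
    k) :=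
  (ext_apply fun v => apply_exchange k .crossUnder .crossUnder (by simpa only [TangleGen.src,
      Nat.add_le_add_iff_right])
    (by simp only [TangleGen.src, TangleGen.tgt]) v)

theorem cap_cup_succ (k : Ket n) (h : i + 1 ≤ n) : cap i (cup (i + 1) k) = k :=
  ext_apply fun v => apply_move k (.zigzag i) (Option.ext fun m => by
    simp only [wordWidth, Option.bind_eq_some_iff, Layer.width_eq_some_iff, TangleGen.src,
      TangleGen.tgt, and_assoc, exists_eq_left', exists_and_left, Option.some.injEq]
    omega) v

theorem cap_succ_cup (k : Ket n) (h : i + 1 ≤ n) : cap (i + 1) (cup i k) = k :=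
  ext_apply fun v => apply_move k (.zagzig i) (Option.ext fun m => by
    simp only [wordWidth, Option.bind_eq_some_iff, Layer.width_eq_some_iff, TangleGen.src,
      TangleGen.tgt, and_assoc, exists_eq_left', exists_and_left, Option.some.injEq]
    omega) v

theorem cap_succ_overX (k : Ket (n + 2)) (i : ℕ) : cap (i + 1) (overX i k) = cap i (underX (i + 1)
    k) :=
  ext_apply fun v => apply_move k (.overCap i) (Option.ext fun m => by
    simp only [wordWidth, Option.bind_eq_some_iff, Layer.width_eq_some_iff, TangleGen.src,
      TangleGen.tgt, and_assoc, exists_eq_left', exists_and_left, Option.some.injEq]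
    omega) v

theorem overX_cup_succ (k : Ket n) (i : ℕ) : overX i (cup (i + 1) k) = underX (i + 1) (cup i k) :=
  ext_apply fun v => apply_move k (.cupOver i) (Option.ext fun m => by
    simp only [wordWidth, Option.bind_eq_some_iff, Layer.width_eq_some_iff, TangleGen.src,
      TangleGen.tgt, and_assoc, exists_eq_left', exists_and_left, Option.some.injEq]
    omega) v

theorem cap_overX (k : Ket (n + 2)) (i : ℕ) : cap i (overX i k) = cap i k :=
  ext_apply fun v => apply_move k (.reidemeisterOneOverCap i) (Option.ext fun m => by
    simp only [wordWidth, Option.bind_eq_some_iff, Layer.width_eq_some_iff, TangleGen.src,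
      TangleGen.tgt, and_assoc, exists_eq_left', exists_and_left, Option.some.injEq]
    omega) v

theorem overX_cup (k : Ket n) (i : ℕ) : overX i (cup i k) = cup i k :=
  ext_apply fun v => apply_move k (.reidemeisterOneCupOver i) (Option.ext fun m => by
    simp only [wordWidth, Option.bind_eq_some_iff, Layer.width_eq_some_iff, TangleGen.src,
      TangleGen.tgt, and_assoc, exists_eq_left', exists_and_left, Option.some.injEq]
    omega) v

theorem cap_succ_underX (k : Ket (n + 2)) (i : ℕ) : cap (i + 1) (underX i k) = cap i (overX (i + 1)
    k) :=
  ext_apply fun v => apply_move k (.underCap i) (Option.ext fun m => by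
    simp only [wordWidth, Option.bind_eq_some_iff, Layer.width_eq_some_iff, TangleGen.src,
      TangleGen.tgt, and_assoc, exists_eq_left', exists_and_left, Option.some.injEq]
    omega) v

theorem underX_cup_succ (k : Ket n) (i : ℕ) : underX i (cup (i + 1) k) = overX (i + 1) (cup i k) :=
  ext_apply fun v => apply_move k (.cupUnder i) (Option.ext fun m => by
    simp only [wordWidth, Option.bind_eq_some_iff, Layer.width_eq_some_iff, TangleGen.src,
      TangleGen.tgt, and_assoc, exists_eq_left', exists_and_left, Option.some.injEq]
    omega) v

theorem cap_underX (k : Ket (n + 2)) (i : ℕ) : cap i (underX i k) = cap i k :=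
  ext_apply fun v => apply_move k (.reidemeisterOneUnderCap i) (Option.ext fun m => by
    simp only [wordWidth, Option.bind_eq_some_iff, Layer.width_eq_some_iff, TangleGen.src,
      TangleGen.tgt, and_assoc, exists_eq_left', exists_and_left, Option.some.injEq]
    omega) v

theorem underX_cup (k : Ket n) (i : ℕ) : underX i (cup i k) = cup i k :=
  ext_apply fun v => apply_move k (.reidemeisterOneCupUnder i) (Option.ext fun m => by
    simp only [wordWidth, Option.bind_eq_some_iff, Layer.width_eq_some_iff, TangleGen.src,
      TangleGen.tgt, and_assoc, exists_eq_left', exists_and_left, Option.some.injEq]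
    omega) v

theorem underX_overX (k : Ket n) (h : i + 2 ≤ n) : underX i (overX i k) = k :=
  ext_apply fun v => apply_move k (.reidemeisterTwo i) (Option.ext fun m => by
    simp only [wordWidth, Option.bind_eq_some_iff, Layer.width_eq_some_iff, TangleGen.src,
      TangleGen.tgt, and_assoc, exists_eq_left', exists_and_left, Option.some.injEq]
    omega) v

theorem overX_underX (k : Ket n) (h : i + 2 ≤ n) : overX i (underX i k) = k :=
  ext_apply fun v => apply_move k (.reidemeisterTwo' i) (Option.ext fun m => by
    simp only [wordWidth, Option.bind_eq_some_iff, Layer.width_eq_some_iff, TangleGen.src,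
      TangleGen.tgt, and_assoc, exists_eq_left', exists_and_left, Option.some.injEq]
    omega) v

theorem overX_braid (k : Ket n) (i : ℕ) :
    overX i (overX (i + 1) (overX i k)) = overX (i + 1) (overX i (overX (i + 1) k)) :=
  ext_apply fun v => apply_move k (.reidemeisterThree i) (Option.ext fun m => by
    simp only [wordWidth, Option.bind_eq_some_iff, Layer.width_eq_some_iff, TangleGen.src,
      TangleGen.tgt, and_assoc, exists_eq_left', exists_and_left, Option.some.injEq]
    omega) v

theorem overX_add_underX (k : Ket (n + 2)) (h : i ≤ n) :
    overX i k + underX i k = (T 1 : LaurentPolynomial ℤ) • (k + cup i (cap i k)) := by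
  refine ext_apply fun v => ?_
  obtain ⟨k, h1, h2, h3⟩ := k
  by_cases hv : wordWidth v (n + 2) = some 0
  · exact h3 [] v i (n + 2) rfl (by omega) hv
  -- Crossings and smoothings all preserve the width, so for a `v` that does not close up all four
  -- terms are zero.
  · have e : ∀ g : TangleGen, g.src = 2 → g.tgt = 2 →
        wordWidth (⟨g, i⟩ :: v) (n + 2) ≠ some 0 := by
      intro g hg hg'
      simpa [wordWidth, Layer.width, hg, hg', h] using hv
    have e' : wordWidth (capAt i :: cupAt i :: v) (n + 2) ≠ some 0 := by
      simpa [wordWidth, Layer.width, TangleGen.src, TangleGen.tgt, h] using hv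
    change k (overAt i :: v) + k (underAt i :: v) =
      (T 1 : LaurentPolynomial ℤ) • (k v + k (capAt i :: cupAt i :: v))
    rw [h1 _ (e .crossOver rfl rfl), h1 _ (e .crossUnder rfl rfl), h1 _ hv, h1 _ e']
    simp

/-- The class of the empty diagram. -/
noncomputable def empty : Ket 0 :=
  ⟨wordSkein, fun _ hv => dif_neg hv, fun _ _ _ _ hab ha hb => wordSkein_move hab ha hb,
    fun u v i m hu hi hv => by
      have e : ∀ g : TangleGen, g.src = 2 → g.tgt = 2 →
          wordWidth (u ++ [⟨g, i⟩] ++ v) 0 = some 0 := by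
        intro g hg hg'
        simp [wordWidth_append, wordWidth, Layer.width, hg, hg', hi, hu, hv,
          show m - 2 + 2 = m by omega]
      refine wordSkein_skein (e _ rfl rfl) (e _ rfl rfl) ?_ ?_
      · simp [wordWidth_append, hu, hv]
      · simp [wordWidth_append, wordWidth, Layer.width, TangleGen.src, TangleGen.tgt, hi, hu,
          show i ≤ m - 2 by omega, show m - 2 + 2 = m by omega, hv]⟩

end Ket

/-! ## Tangles with six endpoints -/

namespace Ket

variable {n : ℕ} {i : ℕ}

/-- Only the third Reidemeister move for `crossOver` is a generating move; this one is obtained by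
inverting both sides. -/
theorem underX_braid (k : Ket n) (h : i + 3 ≤ n) :
    underX i (underX (i + 1) (underX i k)) = underX (i + 1) (underX i (underX (i + 1) k)) := by
  have h1 : i + 2 ≤ n := by omega
  have h2 : i + 1 + 2 ≤ n := by omega
  have key := overX_braid (underX (i + 1) (underX i (underX (i + 1) k))) i
  rw [overX_underX (i := i + 1) _ h2, overX_underX _ h1, overX_underX _ h2] at key
  conv_lhs => rw [← key]
  rw [underX_overX _ h1, underX_overX _ h2, underX_overX _ h1]

/-- The skein relation at `b'`: the opposite crossing returns to `b`, and in the smoothed term the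
crossing in `b'` is a removable kink. This computes a crossing on every tangle that already ends in
the same crossing. -/
theorem overX_of_overX {b b' : Ket (n + 2)} (h : i ≤ n) (hb : overX i b = b') :
    overX i b' = (T 1 : LaurentPolynomial ℤ) • (b' + cup i (cap i b)) - b := by
  subst hb
  rw [← cap_overX, ← overX_add_underX _ h, underX_overX _ (by omega), add_sub_cancel_right]

theorem underX_of_underX {b b' : Ket (n + 2)} (h : i ≤ n) (hb : underX i b = b') :
    underX i b' = (T 1 : LaurentPolynomial ℤ) • (b' + cup i (cap i b)) - b := by
  subst hb
  rw [← cap_underX, ← overX_add_underX _ h, overX_underX _ (by omega), add_sub_cancel_left]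

theorem underX_eq_of_overX_eq {b b' : Ket n} (h : i + 2 ≤ n) (hb : overX i b = b') :
    underX i b' = b := by
  rw [← hb, underX_overX _ h]

theorem underX_eq (k : Ket (n + 2)) (h : i ≤ n) :
    underX i k = (T 1 : LaurentPolynomial ℤ) • (k + cup i (cap i k)) - overX i k := by
  rw [← overX_add_underX _ h, add_sub_cancel_left]

/-- Tangles with six endpoints. -/
abbrev Ket6 : Type := Ket (0 + 2 + 2 + 2)

/-! A basis of the tangles with six endpoints, named by the pairs of endpoints that are joined. -/

noncomputable def arcs_01_23 : Ket (0 + 2 + 2) := cup 2 (cup 0 empty)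
noncomputable def arcs_03_12 : Ket (0 + 2 + 2) := cup 1 (cup 0 empty)
noncomputable def arcs_01_23_45 : Ket6 := cup 4 arcs_01_23
noncomputable def arcs_03_12_45 : Ket6 := cup 4 arcs_03_12
noncomputable def arcs_01_25_34 : Ket6 := cup 3 arcs_01_23
noncomputable def arcs_05_12_34 : Ket6 := cup 3 arcs_03_12
noncomputable def arcs_05_14_23 : Ket6 := cup 2 arcs_03_12
-- Arcs that must cross are built only with `overX 1`, `underX 3` and `underX 2`, the crossings
-- above the base of the Kanenobu diagrams, so that many matrix entries hold by definition. The
-- computation needs only that these operators preserve the span of the family; linear independence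
-- plays no role.
noncomputable def arcs_02_13_45 : Ket6 := overX 1 arcs_01_23_45
noncomputable def arcs_01_24_35 : Ket6 := underX 3 arcs_01_23_45
noncomputable def arcs_02_14_35 : Ket6 := overX 1 arcs_01_24_35
noncomputable def arcs_04_12_35 : Ket6 := underX 3 arcs_03_12_45
noncomputable def arcs_02_15_34 : Ket6 := overX 1 arcs_01_25_34
noncomputable def arcs_05_13_24 : Ket6 := underX 2 arcs_05_12_34
noncomputable def arcs_03_15_24 : Ket6 := underX 2 arcs_02_15_34
noncomputable def arcs_04_13_25 : Ket6 := underX 2 arcs_04_12_35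
noncomputable def arcs_03_14_25 : Ket6 := underX 2 arcs_02_14_35
noncomputable def arcs_04_15_23 : Ket6 := cup 2 (overX 1 arcs_01_23)

theorem cup_one_arcs_01_23 : cup 1 arcs_01_23 = arcs_03_12_45 := (cup_cup (j := 2) _ (by
    omega)).symm

theorem cup_two_arcs_01_23 : cup 2 arcs_01_23 = arcs_01_23_45 := (cup_cup (j := 2) _ (by
    omega)).symm

theorem cup_one_arcs_03_12 : cup 1 arcs_03_12 = arcs_05_12_34 := (cup_cup (j := 1) _ (by
    omega)).symm

/-! ### The action of the crossings -/

theorem underX_two_arcs_01_23_45 : underX 2 arcs_01_23_45 = arcs_01_23_45 := by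
  rw [← cup_two_arcs_01_23, underX_cup]

theorem underX_two_arcs_03_12_45 : underX 2 arcs_03_12_45 = arcs_02_13_45 := by
  rw [arcs_03_12_45, underX_cup_left (j := 4) _ (by omega), arcs_03_12, ← overX_cup_succ,
    ← overX_cup_left (j := 4) _ (by omega), arcs_02_13_45, arcs_01_23_45, arcs_01_23]

theorem overX_two_arcs_01_25_34 : overX 2 arcs_01_25_34 = arcs_01_24_35 := by
  rw [arcs_01_25_34, overX_cup_succ, cup_two_arcs_01_23, arcs_01_24_35]

theorem underX_two_arcs_05_14_23 : underX 2 arcs_05_14_23 = arcs_05_14_23 := underX_cup _ _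

theorem underX_two_arcs_04_15_23 : underX 2 arcs_04_15_23 = arcs_04_15_23 := underX_cup _ _

theorem overX_one_arcs_05_14_23 : overX 1 arcs_05_14_23 = arcs_05_13_24 := by
  rw [arcs_05_14_23, overX_cup_succ, cup_one_arcs_03_12, arcs_05_13_24]

theorem overX_three_arcs_05_14_23 : overX 3 arcs_05_14_23 = arcs_05_13_24 := by
  rw [arcs_05_14_23, ← underX_cup_succ, arcs_05_13_24, arcs_05_12_34]

theorem overX_one_arcs_03_12_45 : overX 1 arcs_03_12_45 = arcs_03_12_45 := by
  rw [← cup_one_arcs_01_23, overX_cup]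

theorem overX_one_arcs_05_12_34 : overX 1 arcs_05_12_34 = arcs_05_12_34 := by
  rw [← cup_one_arcs_03_12, overX_cup]

theorem overX_one_arcs_04_12_35 : overX 1 arcs_04_12_35 = arcs_04_12_35 := by
  rw [arcs_04_12_35, ← underX_overX_comm (j := 3) _ (by omega), overX_one_arcs_03_12_45]

theorem underX_three_arcs_01_25_34 : underX 3 arcs_01_25_34 = arcs_01_25_34 := underX_cup _ _

theorem underX_three_arcs_05_12_34 : underX 3 arcs_05_12_34 = arcs_05_12_34 := underX_cup _ _

theorem underX_three_arcs_02_15_34 : underX 3 arcs_02_15_34 = arcs_02_15_34 := by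
  rw [arcs_02_15_34, underX_overX_comm (j := 3) _ (by omega), underX_three_arcs_01_25_34]

theorem underX_three_arcs_02_13_45 : underX 3 arcs_02_13_45 = arcs_02_14_35 := by
  rw [arcs_02_13_45, underX_overX_comm (j := 3) _ (by omega), arcs_02_14_35, arcs_01_24_35]

theorem overX_three_arcs_04_15_23 : overX 3 arcs_04_15_23 = arcs_03_15_24 := by
  rw [arcs_04_15_23, ← underX_cup_succ, arcs_03_15_24, arcs_02_15_34, arcs_01_25_34, overX_cup_left
    (j := 3) _ (by omega)]

theorem underX_three_arcs_04_13_25 : underX 3 arcs_04_13_25 = arcs_03_14_25 := by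
  rw [arcs_04_13_25, arcs_04_12_35, ← underX_braid _ (by omega), underX_two_arcs_03_12_45,
    underX_three_arcs_02_13_45, arcs_03_14_25]

/-- The inner tangle is `arcs_04_15_23` with its crossing changed. It lies outside the family, but
is the preimage of `arcs_04_13_25` needed for `overX_of_overX`. -/
theorem overX_one_cup_two_underX_one : overX 1 (cup 2 (underX 1 arcs_01_23)) = arcs_04_13_25 := by
  rw [overX_cup_succ, ← underX_cup_right (j := 1) _ (by omega), cup_one_arcs_01_23, arcs_04_13_25,
    arcs_04_12_35]

theorem cup_two_underX_one : cup 2 (underX 1 arcs_01_23) = (T 1 : LaurentPolynomial ℤ)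
    • (arcs_01_23_45 + arcs_05_14_23) - arcs_04_15_23 := by
  rw [underX_eq _ (by omega), map_sub, map_smul, map_add, cup_two_arcs_01_23, arcs_01_23,
    cap_cup_succ _ (by omega), arcs_05_14_23, arcs_03_12, arcs_04_15_23, arcs_01_23]

theorem cup_cap_one_arcs_01_23_45 : cup 1 (cap 1 arcs_01_23_45) = arcs_03_12_45 := by
  rw [arcs_01_23_45, cap_cup_left (j := 2) _ (by omega), arcs_01_23, cap_cup_succ _ (by omega), ←
    arcs_01_23,
    cup_one_arcs_01_23]

theorem cup_cap_one_arcs_01_24_35 : cup 1 (cap 1 arcs_01_24_35) = arcs_04_12_35 := by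
  rw [arcs_01_24_35, cap_underX_right (j := 1) _ (by omega), ← underX_cup_right (j := 1) _ (by
    omega),
    cup_cap_one_arcs_01_23_45, arcs_04_12_35]

theorem cup_cap_one_arcs_01_25_34 : cup 1 (cap 1 arcs_01_25_34) = arcs_05_12_34 := by
  rw [arcs_01_25_34, cap_cup_left (j := 1) _ (by omega), arcs_01_23, cap_cup_succ _ (by omega), ←
    arcs_03_12,
    cup_one_arcs_03_12]

theorem cup_cap_one_arcs_05_14_23 : cup 1 (cap 1 arcs_05_14_23) = arcs_05_12_34 := by
  rw [arcs_05_14_23, cap_cup_succ _ (by omega), cup_one_arcs_03_12]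

theorem cup_cap_three_arcs_01_23_45 : cup 3 (cap 3 arcs_01_23_45) = arcs_01_25_34 := by
  rw [arcs_01_23_45, cap_cup_succ _ (by omega), arcs_01_25_34]

theorem cup_cap_three_arcs_02_13_45 : cup 3 (cap 3 arcs_02_13_45) = arcs_02_15_34 := by
  rw [arcs_02_13_45, cap_overX_left (j := 3) _ (by omega), ← overX_cup_left (j := 3) _ (by omega),
    cup_cap_three_arcs_01_23_45,
    arcs_02_15_34]

theorem cup_cap_three_arcs_03_12_45 : cup 3 (cap 3 arcs_03_12_45) = arcs_05_12_34 := by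
  rw [arcs_03_12_45, cap_cup_succ _ (by omega), arcs_05_12_34]

theorem cup_cap_three_arcs_05_14_23 : cup 3 (cap 3 arcs_05_14_23) = arcs_05_12_34 := by
  rw [arcs_05_14_23, cap_succ_cup _ (by omega), arcs_05_12_34]

theorem cup_cap_two_arcs_03_12_45 : cup 2 (cap 2 arcs_03_12_45) = arcs_01_23_45 := by
  rw [arcs_03_12_45, cap_cup_left (j := 2) _ (by omega), arcs_03_12, cap_succ_cup _ (by omega), ←
    arcs_01_23,
    cup_two_arcs_01_23]

theorem cup_cap_two_arcs_01_25_34 : cup 2 (cap 2 arcs_01_25_34) = arcs_01_23_45 := by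
  rw [arcs_01_25_34, cap_cup_succ _ (by omega), cup_two_arcs_01_23]

theorem cup_cap_two_arcs_05_12_34 : cup 2 (cap 2 arcs_05_12_34) = arcs_05_14_23 := by
  rw [arcs_05_12_34, cap_cup_succ _ (by omega), arcs_05_14_23]

theorem cup_cap_two_arcs_02_15_34 : cup 2 (cap 2 arcs_02_15_34) = arcs_04_15_23 := by
  rw [arcs_02_15_34, arcs_01_25_34, overX_cup_left (j := 3) _ (by omega), cap_cup_succ _ (by
    omega), arcs_04_15_23]

theorem cup_cap_two_arcs_04_12_35 : cup 2 (cap 2 arcs_04_12_35) = cup 2 (underX 1 arcs_01_23) := by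
  rw [arcs_04_12_35, ← cap_succ_overX, arcs_03_12_45, overX_cup_left (j := 4) _ (by omega),
    cap_cup_succ _ (by omega),
    arcs_03_12, ← underX_cup_succ, arcs_01_23]

theorem cap_two_arcs_02_14_35 : cap 2 arcs_02_14_35 = arcs_03_12 := by
  rw [arcs_02_14_35, cap_succ_overX, ← overX_two_arcs_01_25_34, underX_overX _ (by omega),
    arcs_01_25_34,
    cap_cup_left (j := 1) _ (by omega), arcs_01_23, cap_cup_succ _ (by omega), arcs_03_12]

theorem cup_cap_two_arcs_02_14_35 : cup 2 (cap 2 arcs_02_14_35) = arcs_05_14_23 := by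
  rw [cap_two_arcs_02_14_35, arcs_05_14_23]

theorem cup_cap_three_arcs_04_15_23 : cup 3 (cap 3 arcs_04_15_23) = arcs_02_15_34 := by
  rw [arcs_04_15_23, cap_succ_cup _ (by omega), ← overX_cup_left (j := 3) _ (by omega),
    arcs_02_15_34, arcs_01_25_34]

theorem cup_cap_three_arcs_04_13_25 : cup 3 (cap 3 arcs_04_13_25) = arcs_01_25_34 := by
  rw [arcs_04_13_25, cap_succ_underX, arcs_04_12_35, overX_underX _ (by omega), arcs_03_12_45,
    cap_cup_left (j := 2) _ (by omega), arcs_03_12, cap_succ_cup _ (by omega), ← arcs_01_23,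
        arcs_01_25_34]

theorem cup_cap_one_cup_two_underX_one : cup 1 (cap 1 (cup 2 (underX 1 arcs_01_23))) =
    arcs_04_12_35 := by
  rw [cap_cup_succ _ (by omega), ← underX_cup_right (j := 1) _ (by omega), cup_one_arcs_01_23,
    arcs_04_12_35]

/-! ### Tangles with four endpoints -/

noncomputable def arcs_02_13 : Ket (0 + 2 + 2) := overX 1 arcs_01_23

theorem underX_two_arcs_03_12 : underX 2 arcs_03_12 = arcs_02_13 := by
  rw [arcs_03_12, ← overX_cup_succ, arcs_02_13, arcs_01_23]

theorem underX_zero_arcs_03_12 : underX 0 arcs_03_12 = arcs_02_13 := by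
  rw [arcs_03_12, underX_cup_succ, ← cup_cup (j := 0) _ le_rfl, arcs_02_13, arcs_01_23]

theorem underX_zero_arcs_02_13 :
    underX 0 arcs_02_13 = (T 1 : LaurentPolynomial ℤ) • (arcs_02_13 + arcs_01_23) - arcs_03_12 := by
  rw [underX_of_underX (by omega) underX_zero_arcs_03_12, ← cap_underX, underX_zero_arcs_03_12,
    arcs_02_13, ← cap_succ_underX, arcs_01_23,
    underX_cup_left (j := 2) _ (by omega), underX_cup, cap_cup_succ _ (by omega),
    ← cup_cup (j := 0) _ le_rfl]

theorem cup_four_arcs_02_13 : cup 4 arcs_02_13 = arcs_02_13_45 := by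
  rw [arcs_02_13, ← overX_cup_left (j := 4) _ (by omega), arcs_02_13_45, arcs_01_23_45]

theorem cup_three_arcs_02_13 : cup 3 arcs_02_13 = arcs_02_15_34 := by
  rw [arcs_02_13, ← overX_cup_left (j := 3) _ (by omega), arcs_02_15_34, arcs_01_25_34]

theorem overX_four_underX_three_cup_four (k : Ket (0 + 2 + 2)) :
    overX 4 (underX 3 (cup 4 k)) =
      (T 1 : LaurentPolynomial ℤ) • (underX 3 (cup 4 k) + cup 4 k) - cup 3 k := by
  rw [overX_of_overX (b := cup 3 k) (by omega) (underX_cup_succ k 3).symm,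
    cap_succ_cup _ (by omega)]

/-- The lower part of the diagrams of the Kanenobu knots. -/
noncomputable def kanenobuBase : Ket6 := overX 4 (underX 0 (underX 3 (overX 1 arcs_01_23_45)))

/-- The left and the right pair of crossings expand independently, each into three tangles with
coefficients `x`, `x`, `-1`. The nine terms are the products. -/
theorem kanenobuBase_eq : kanenobuBase =
    ((T 1 : LaurentPolynomial ℤ) ^ 2) • (arcs_02_14_35 + arcs_02_13_45 + arcs_01_24_35 +
        arcs_01_23_45)
      - (T 1 : LaurentPolynomial ℤ) • (arcs_02_15_34 + arcs_01_25_34 + arcs_04_12_35 +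
        arcs_03_12_45) +
      arcs_05_12_34 := by
  have h : kanenobuBase = overX 4 (underX 3 (cup 4 (underX 0 arcs_02_13))) := by
    rw [kanenobuBase, ← arcs_02_13_45, ← cup_four_arcs_02_13, ← underX_underX_comm (j := 3) _ (by
      omega),
      underX_cup_left (j := 4) _ (by omega)]
  rw [h, overX_four_underX_three_cup_four, underX_zero_arcs_02_13]
  simp only [map_sub, map_smul, map_add, cup_four_arcs_02_13, cup_three_arcs_02_13,
    underX_three_arcs_02_13_45]
  rw [← arcs_01_23_45, ← arcs_01_24_35, ← arcs_03_12_45, ← arcs_01_25_34, ← arcs_05_12_34, ←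
    arcs_04_12_35]
  module

/-! ### Closing tangles -/

/-- The value of the `Q`-polynomial on the unlink with two components. -/
noncomputable def unlinkTwo : LaurentPolynomial ℤ := 2 * T (-1) - 1

theorem T_mul_unlinkTwo : (T 1 : LaurentPolynomial ℤ) * unlinkTwo = 2 - T 1 := by
  have h : (T 1 : LaurentPolynomial ℤ) * T (-1) = 1 := by rw [← T_add]; simp
  rw [unlinkTwo]
  linear_combination 2 * h

theorem eq_unlinkTwo_smul {a b : Ket n}
    (h : (2 : LaurentPolynomial ℤ) • a =
      (T 1 : LaurentPolynomial ℤ) • (a + b)) : b = unlinkTwo • a := by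
  have h1 : (T (-1) : LaurentPolynomial ℤ) * T 1 = 1 := by rw [← T_add]; simp
  have h2 : (T 1 : LaurentPolynomial ℤ) • b = (T 1 : LaurentPolynomial ℤ) • unlinkTwo • a := by
    rw [smul_smul, T_mul_unlinkTwo, sub_smul, h]
    module
  have h3 := congrArg (fun k => (T (-1) : LaurentPolynomial ℤ) • k) h2
  simpa only [smul_smul, ← mul_assoc, h1, one_mul, one_smul] using h3

theorem two_smul_cup (k : Ket n) (h : i ≤ n) : (2 : LaurentPolynomial ℤ) • cup i k =
    (T 1 : LaurentPolynomial ℤ) • (cup i k + cup i (cap i (cup i k))) := by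
  rw [← overX_add_underX _ h, overX_cup, underX_cup, two_smul]

/-- The skein relation for a kink gives `2 = x (1 + circle)` on a local minimum, and `cap i` then
straightens that minimum against the strand to its left. A strand to the left is therefore required,
and a last isolated circle remains as the class of the unknot. -/
theorem cap_cup_of_pos (k : Ket n) (h : i + 1 ≤ n) :
    cap (i + 1) (cup (i + 1) k) = unlinkTwo • k := by
  refine eq_unlinkTwo_smul ?_
  have := congrArg (cap i) (two_smul_cup k (i := i + 1) (by omega))
  simpa only [map_smul, map_add, cap_cup_succ _ h] using this

/-- The circle. -/
noncomputable def circle : Ket 0 := cap 0 (cup 0 empty)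

noncomputable def closeFour : Ket (0 + 2 + 2) →ₗ[LaurentPolynomial ℤ] Ket 0 := cap 0 ∘ₗ cap 2

theorem closeFour_arcs_01_23 : closeFour arcs_01_23 = unlinkTwo • circle := by
  rw [closeFour, LinearMap.comp_apply, arcs_01_23, cap_cup_of_pos _ (by omega), map_smul, circle]

theorem closeFour_arcs_03_12 : closeFour arcs_03_12 = circle := by
  rw [closeFour, LinearMap.comp_apply, arcs_03_12, cap_succ_cup _ (by omega), circle]

theorem cap_two_arcs_02_13 : cap 2 arcs_02_13 = cup 0 empty := by
  rw [arcs_02_13, cap_succ_overX, arcs_01_23, underX_cup, cap_cup_succ _ (by omega)]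

theorem closeFour_arcs_02_13 : closeFour arcs_02_13 = circle := by
  rw [closeFour, LinearMap.comp_apply, cap_two_arcs_02_13, circle]

theorem closeFour_underX_two_arcs_02_13 : closeFour (underX 2 arcs_02_13) = circle := by
  rw [closeFour, LinearMap.comp_apply, cap_underX, cap_two_arcs_02_13, circle]

/-- The plat closure. -/
noncomputable def close : Ket6 →ₗ[LaurentPolynomial ℤ] Ket 0 := closeFour ∘ₗ cap 4

theorem close_apply (k : Ket6) : close k = closeFour (cap 4 k) := rfl

theorem cap_four_arcs_01_23_45 : cap 4 arcs_01_23_45 = unlinkTwo • arcs_01_23 :=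
  cap_cup_of_pos _ (by omega)
theorem cap_four_arcs_03_12_45 : cap 4 arcs_03_12_45 = unlinkTwo • arcs_03_12 :=
  cap_cup_of_pos _ (by omega)
theorem cap_four_arcs_01_25_34 : cap 4 arcs_01_25_34 = arcs_01_23 := cap_succ_cup _ (by omega)
theorem cap_four_arcs_05_12_34 : cap 4 arcs_05_12_34 = arcs_03_12 := cap_succ_cup _ (by omega)
theorem cap_four_arcs_05_14_23 : cap 4 arcs_05_14_23 = arcs_01_23 := by
  rw [arcs_05_14_23, cap_cup_right (j := 2) _ (by omega), arcs_03_12, cap_succ_cup _ (by omega),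
    arcs_01_23]
theorem cap_four_arcs_02_13_45 : cap 4 arcs_02_13_45 = unlinkTwo • arcs_02_13 := by
  rw [arcs_02_13_45, cap_overX_left (j := 4) _ (by omega), cap_four_arcs_01_23_45, map_smul,
    arcs_02_13]
theorem cap_four_arcs_01_24_35 : cap 4 arcs_01_24_35 = arcs_01_23 := by
  rw [arcs_01_24_35, cap_succ_underX, arcs_01_23_45, overX_cup, cap_cup_succ _ (by omega)]
theorem cap_four_arcs_02_14_35 : cap 4 arcs_02_14_35 = arcs_02_13 := by
  rw [arcs_02_14_35, cap_overX_left (j := 4) _ (by omega), cap_four_arcs_01_24_35, arcs_02_13]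
theorem cap_four_arcs_04_12_35 : cap 4 arcs_04_12_35 = arcs_03_12 := by
  rw [arcs_04_12_35, cap_succ_underX, arcs_03_12_45, overX_cup, cap_cup_succ _ (by omega)]
theorem cap_four_arcs_02_15_34 : cap 4 arcs_02_15_34 = arcs_02_13 := by
  rw [arcs_02_15_34, cap_overX_left (j := 4) _ (by omega), cap_four_arcs_01_25_34, arcs_02_13]
theorem cap_four_arcs_05_13_24 : cap 4 arcs_05_13_24 = arcs_02_13 := by
  rw [arcs_05_13_24, cap_underX_left (j := 4) _ (by omega), cap_four_arcs_05_12_34,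
    underX_two_arcs_03_12]
theorem cap_four_arcs_03_15_24 : cap 4 arcs_03_15_24 = underX 2 arcs_02_13 := by
  rw [arcs_03_15_24, cap_underX_left (j := 4) _ (by omega), cap_four_arcs_02_15_34]
theorem cap_four_arcs_04_13_25 : cap 4 arcs_04_13_25 = arcs_02_13 := by
  rw [arcs_04_13_25, cap_underX_left (j := 4) _ (by omega), cap_four_arcs_04_12_35,
    underX_two_arcs_03_12]
theorem cap_four_arcs_03_14_25 : cap 4 arcs_03_14_25 = underX 2 arcs_02_13 := by
  rw [arcs_03_14_25, cap_underX_left (j := 4) _ (by omega), cap_four_arcs_02_14_35]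
theorem cap_four_arcs_04_15_23 : cap 4 arcs_04_15_23 = arcs_01_23 := by
  rw [arcs_04_15_23, cap_cup_right (j := 2) _ (by omega), ← arcs_02_13, cap_two_arcs_02_13,
    arcs_01_23]

end Ket

/-! ## The knots `K(p, q)` with small `p` and `q` -/

set_option linter.unusedSimpArgs false

namespace Ket

/-! ### Matrices of the crossings with respect to the family of 15 tangles. -/

theorem overX_one_arcs_01_23_45 : overX 1 arcs_01_23_45 = arcs_02_13_45 := rfl
theorem overX_one_arcs_01_24_35 : overX 1 arcs_01_24_35 = arcs_02_14_35 := rfl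
theorem overX_one_arcs_01_25_34 : overX 1 arcs_01_25_34 = arcs_02_15_34 := rfl
theorem underX_three_arcs_01_23_45 : underX 3 arcs_01_23_45 = arcs_01_24_35 := rfl
theorem underX_three_arcs_03_12_45 : underX 3 arcs_03_12_45 = arcs_04_12_35 := rfl
theorem underX_two_arcs_02_14_35 : underX 2 arcs_02_14_35 = arcs_03_14_25 := rfl
theorem underX_two_arcs_04_12_35 : underX 2 arcs_04_12_35 = arcs_04_13_25 := rfl
theorem underX_two_arcs_02_15_34 : underX 2 arcs_02_15_34 = arcs_03_15_24 := rfl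
theorem underX_two_arcs_05_12_34 : underX 2 arcs_05_12_34 = arcs_05_13_24 := rfl

theorem underX_three_arcs_03_15_24 : underX 3 arcs_03_15_24 = arcs_04_15_23 :=
    underX_eq_of_overX_eq (by omega) overX_three_arcs_04_15_23
theorem underX_three_arcs_05_13_24 : underX 3 arcs_05_13_24 = arcs_05_14_23 :=
    underX_eq_of_overX_eq (by omega) overX_three_arcs_05_14_23
theorem underX_two_arcs_01_24_35 : underX 2 arcs_01_24_35 = arcs_01_25_34 := underX_eq_of_overX_eq
    (by omega) overX_two_arcs_01_25_34

theorem overX_one_arcs_02_13_45 :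
    overX 1 arcs_02_13_45 = (T 1 : ℤ[T;T⁻¹]) • arcs_02_13_45 + (T 1 : ℤ[T;T⁻¹]) • arcs_03_12_45
      - arcs_01_23_45 := by
  rw [overX_of_overX (by omega) overX_one_arcs_01_23_45, cup_cap_one_arcs_01_23_45]
  module

theorem overX_one_arcs_02_14_35 :
    overX 1 arcs_02_14_35 = (T 1 : ℤ[T;T⁻¹]) • arcs_02_14_35 + (T 1 : ℤ[T;T⁻¹]) • arcs_04_12_35
      - arcs_01_24_35 := by
  rw [overX_of_overX (by omega) overX_one_arcs_01_24_35, cup_cap_one_arcs_01_24_35]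
  module

theorem overX_one_arcs_02_15_34 :
    overX 1 arcs_02_15_34 = (T 1 : ℤ[T;T⁻¹]) • arcs_02_15_34 + (T 1 : ℤ[T;T⁻¹]) • arcs_05_12_34
      - arcs_01_25_34 := by
  rw [overX_of_overX (by omega) overX_one_arcs_01_25_34, cup_cap_one_arcs_01_25_34]
  module

theorem overX_one_arcs_05_13_24 :
    overX 1 arcs_05_13_24 = (T 1 : ℤ[T;T⁻¹]) • arcs_05_12_34 + (T 1 : ℤ[T;T⁻¹]) • arcs_05_13_24
      - arcs_05_14_23 := by
  rw [overX_of_overX (by omega) overX_one_arcs_05_14_23, cup_cap_one_arcs_05_14_23]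
  module

theorem underX_three_arcs_01_24_35 :
    underX 3 arcs_01_24_35 = (T 1 : ℤ[T;T⁻¹]) • arcs_01_24_35 + (T 1 : ℤ[T;T⁻¹]) • arcs_01_25_34
      - arcs_01_23_45 := by
  rw [underX_of_underX (by omega) underX_three_arcs_01_23_45, cup_cap_three_arcs_01_23_45]
  module

theorem underX_three_arcs_02_14_35 :
    underX 3 arcs_02_14_35 = (T 1 : ℤ[T;T⁻¹]) • arcs_02_14_35 + (T 1 : ℤ[T;T⁻¹]) • arcs_02_15_34
      - arcs_02_13_45 := by
  rw [underX_of_underX (by omega) underX_three_arcs_02_13_45, cup_cap_three_arcs_02_13_45]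
  module

theorem underX_three_arcs_04_12_35 :
    underX 3 arcs_04_12_35 = (T 1 : ℤ[T;T⁻¹]) • arcs_04_12_35 + (T 1 : ℤ[T;T⁻¹]) • arcs_05_12_34
      - arcs_03_12_45 := by
  rw [underX_of_underX (by omega) underX_three_arcs_03_12_45, cup_cap_three_arcs_03_12_45]
  module

theorem underX_three_arcs_03_14_25 :
    underX 3 arcs_03_14_25 = (T 1 : ℤ[T;T⁻¹]) • arcs_01_25_34 + (T 1 : ℤ[T;T⁻¹]) • arcs_03_14_25
      - arcs_04_13_25 := by
  rw [underX_of_underX (by omega) underX_three_arcs_04_13_25, cup_cap_three_arcs_04_13_25]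
  module

theorem underX_two_arcs_02_13_45 :
    underX 2 arcs_02_13_45 = (T 1 : ℤ[T;T⁻¹]) • arcs_01_23_45 + (T 1 : ℤ[T;T⁻¹]) • arcs_02_13_45
      - arcs_03_12_45 := by
  rw [underX_of_underX (by omega) underX_two_arcs_03_12_45, cup_cap_two_arcs_03_12_45]
  module

theorem underX_two_arcs_05_13_24 :
    underX 2 arcs_05_13_24 = (T 1 : ℤ[T;T⁻¹]) • arcs_05_14_23 + (T 1 : ℤ[T;T⁻¹]) • arcs_05_13_24
      - arcs_05_12_34 := by
  rw [underX_of_underX (by omega) underX_two_arcs_05_12_34, cup_cap_two_arcs_05_12_34]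
  module

theorem underX_two_arcs_03_15_24 :
    underX 2 arcs_03_15_24 = (T 1 : ℤ[T;T⁻¹]) • arcs_03_15_24 + (T 1 : ℤ[T;T⁻¹]) • arcs_04_15_23
      - arcs_02_15_34 := by
  rw [underX_of_underX (by omega) underX_two_arcs_02_15_34, cup_cap_two_arcs_02_15_34]
  module

theorem underX_two_arcs_03_14_25 :
    underX 2 arcs_03_14_25 = (T 1 : ℤ[T;T⁻¹]) • arcs_05_14_23 + (T 1 : ℤ[T;T⁻¹]) • arcs_03_14_25
      - arcs_02_14_35 := by
  rw [underX_of_underX (by omega) underX_two_arcs_02_14_35, cup_cap_two_arcs_02_14_35]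
  module

theorem underX_two_arcs_04_13_25 :
    underX 2 arcs_04_13_25 = (T 1 ^ 2 : ℤ[T;T⁻¹]) • arcs_01_23_45 +
      (T 1 ^ 2 : ℤ[T;T⁻¹]) • arcs_05_14_23 + (T 1 : ℤ[T;T⁻¹]) • arcs_04_13_25 +
      (-T 1 : ℤ[T;T⁻¹]) • arcs_04_15_23 - arcs_04_12_35 := by
  rw [underX_of_underX (by omega) underX_two_arcs_04_12_35, cup_cap_two_arcs_04_12_35,
    cup_two_underX_one]
  module

theorem underX_two_arcs_01_25_34 :
    underX 2 arcs_01_25_34 = (T 1 : ℤ[T;T⁻¹]) • arcs_01_23_45 + (T 1 : ℤ[T;T⁻¹]) • arcs_01_25_34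
      - arcs_01_24_35 := by
  rw [underX_eq _ (by omega), cup_cap_two_arcs_01_25_34, overX_two_arcs_01_25_34]
  module

theorem underX_three_arcs_05_14_23 :
    underX 3 arcs_05_14_23 = (T 1 : ℤ[T;T⁻¹]) • arcs_05_12_34 + (T 1 : ℤ[T;T⁻¹]) • arcs_05_14_23
      - arcs_05_13_24 := by
  rw [underX_eq _ (by omega), cup_cap_three_arcs_05_14_23, overX_three_arcs_05_14_23]
  module

theorem underX_three_arcs_04_15_23 :
    underX 3 arcs_04_15_23 = (T 1 : ℤ[T;T⁻¹]) • arcs_02_15_34 + (T 1 : ℤ[T;T⁻¹]) • arcs_04_15_23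
      - arcs_03_15_24 := by
  rw [underX_eq _ (by omega), cup_cap_three_arcs_04_15_23, overX_three_arcs_04_15_23]
  module

theorem overX_one_arcs_04_13_25 :
    overX 1 arcs_04_13_25 = (-T 1 : ℤ[T;T⁻¹]) • arcs_01_23_45 + (T 1 : ℤ[T;T⁻¹]) • arcs_04_12_35 +
      (-T 1 : ℤ[T;T⁻¹]) • arcs_05_14_23 + (T 1 : ℤ[T;T⁻¹]) • arcs_04_13_25 + arcs_04_15_23 := by
  rw [overX_of_overX (by omega) overX_one_cup_two_underX_one, cup_cap_one_cup_two_underX_one,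
    cup_two_underX_one]
  module

theorem overX_one_arcs_04_15_23 :
    overX 1 arcs_04_15_23 = (T 1 : ℤ[T;T⁻¹]) • arcs_02_13_45 + (T 1 : ℤ[T;T⁻¹]) • arcs_05_13_24
      - arcs_04_13_25 := by
  -- The skein relation exchanges the crossing for the opposite one, on which `overX 1` is already
  -- known.
  have h : arcs_04_15_23 = (T 1 : ℤ[T;T⁻¹]) • (arcs_01_23_45 + arcs_05_14_23) - cup 2 (underX 1
      arcs_01_23) := by
    rw [cup_two_underX_one]
    abel
  rw [h, map_sub, map_smul, map_add, overX_one_arcs_01_23_45, overX_one_arcs_05_14_23,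
    overX_one_cup_two_underX_one]
  module

/-- This tangle ends in `underX 3`, which commutes with `overX 1`; the computation reduces to
`arcs_04_13_25`. -/
theorem overX_one_arcs_03_14_25 :
    overX 1 arcs_03_14_25 = (-T 1 : ℤ[T;T⁻¹]) • arcs_01_24_35 + (-T 1 : ℤ[T;T⁻¹]) • arcs_03_12_45 +
      (T 1 ^ 2 : ℤ[T;T⁻¹]) • arcs_04_12_35 + (T 1 : ℤ[T;T⁻¹]) • arcs_02_15_34 +
      (-T 1 ^ 2 : ℤ[T;T⁻¹]) • arcs_05_14_23 + (T 1 : ℤ[T;T⁻¹]) • arcs_05_13_24 +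
      (T 1 : ℤ[T;T⁻¹]) • arcs_03_14_25 + (T 1 : ℤ[T;T⁻¹]) • arcs_04_15_23 - arcs_03_15_24 := by
  rw [← underX_three_arcs_04_13_25, ← underX_overX_comm (j := 3) _ (by omega),
    overX_one_arcs_04_13_25]
  simp only [map_add, map_sub, map_smul, map_neg, underX_three_arcs_01_23_45,
    underX_three_arcs_04_12_35, underX_three_arcs_05_14_23, underX_three_arcs_04_13_25,
    underX_three_arcs_04_15_23]
  module

/-! ### The matrix of `mid` and its action on the base. -/

/-- The crossings between two columns of half twists in the diagrams of the Kanenobu knots. -/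
noncomputable def mid : Ket6 →ₗ[ℤ[T;T⁻¹]] Ket6 := underX 3 ∘ₗ overX 1

theorem mid_apply (k : Ket6) : mid k = underX 3 (overX 1 k) := rfl

theorem mid_apply' (k : Ket6) : mid k = overX 1 (underX 3 k) :=
  underX_overX_comm (j := 3) _ (by omega)

theorem mid_arcs_01_23_45 :
    mid arcs_01_23_45 = arcs_02_14_35 := by
  rw [mid_apply']
  simp only [map_add, map_sub, map_smul, map_neg, overX_one_arcs_01_24_35,
    underX_three_arcs_01_23_45]

theorem mid_arcs_02_13_45 :
    mid arcs_02_13_45 = (T 1 : ℤ[T;T⁻¹]) • arcs_02_14_35 + (T 1 : ℤ[T;T⁻¹]) • arcs_04_12_35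
      - arcs_01_24_35 := by
  rw [mid_apply']
  simp only [map_add, map_sub, map_smul, map_neg, overX_one_arcs_02_14_35,
    underX_three_arcs_02_13_45]

theorem mid_arcs_01_24_35 :
    mid arcs_01_24_35 = (T 1 : ℤ[T;T⁻¹]) • arcs_02_14_35 + (T 1 : ℤ[T;T⁻¹]) • arcs_02_15_34
      - arcs_02_13_45 := by
  rw [mid_apply']
  simp only [map_add, map_sub, map_smul, map_neg, overX_one_arcs_01_25_34, overX_one_arcs_01_23_45,
    overX_one_arcs_01_24_35, underX_three_arcs_01_24_35]

theorem mid_arcs_02_14_35 :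
    mid arcs_02_14_35 = arcs_01_23_45 + (-T 1 : ℤ[T;T⁻¹]) • arcs_02_13_45 +
      (-T 1 : ℤ[T;T⁻¹]) • arcs_01_24_35 + (T 1 ^ 2 : ℤ[T;T⁻¹]) • arcs_02_14_35 +
      (-T 1 : ℤ[T;T⁻¹]) • arcs_03_12_45 + (T 1 ^ 2 : ℤ[T;T⁻¹]) • arcs_04_12_35 +
      (-T 1 : ℤ[T;T⁻¹]) • arcs_01_25_34 + (T 1 ^ 2 : ℤ[T;T⁻¹]) • arcs_02_15_34 +
      (T 1 ^ 2 : ℤ[T;T⁻¹]) • arcs_05_12_34 := by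
  rw [mid_apply']
  simp only [map_add, map_sub, map_smul, map_neg, overX_one_arcs_02_15_34, overX_one_arcs_02_13_45,
    overX_one_arcs_02_14_35, underX_three_arcs_02_14_35]
  module

theorem mid_arcs_03_12_45 :
    mid arcs_03_12_45 = arcs_04_12_35 := by
  rw [mid_apply']
  simp only [map_add, map_sub, map_smul, map_neg, overX_one_arcs_04_12_35,
    underX_three_arcs_03_12_45]

theorem mid_arcs_04_12_35 :
    mid arcs_04_12_35 = (T 1 : ℤ[T;T⁻¹]) • arcs_04_12_35 + (T 1 : ℤ[T;T⁻¹]) • arcs_05_12_34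
      - arcs_03_12_45 := by
  rw [mid_apply']
  simp only [map_add, map_sub, map_smul, map_neg, overX_one_arcs_03_12_45, overX_one_arcs_04_12_35,
    overX_one_arcs_05_12_34, underX_three_arcs_04_12_35]

theorem mid_arcs_01_25_34 :
    mid arcs_01_25_34 = arcs_02_15_34 := by
  rw [mid_apply']
  simp only [map_add, map_sub, map_smul, map_neg, overX_one_arcs_01_25_34,
    underX_three_arcs_01_25_34]

theorem mid_arcs_02_15_34 :
    mid arcs_02_15_34 = (T 1 : ℤ[T;T⁻¹]) • arcs_02_15_34 + (T 1 : ℤ[T;T⁻¹]) • arcs_05_12_34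
      - arcs_01_25_34 := by
  rw [mid_apply']
  simp only [map_add, map_sub, map_smul, map_neg, overX_one_arcs_02_15_34,
    underX_three_arcs_02_15_34]

theorem mid_arcs_05_12_34 :
    mid arcs_05_12_34 = arcs_05_12_34 := by
  rw [mid_apply']
  simp only [map_add, map_sub, map_smul, map_neg, overX_one_arcs_05_12_34,
    underX_three_arcs_05_12_34]

theorem mid_arcs_05_14_23 :
    mid arcs_05_14_23 = arcs_05_14_23 := by
  rw [mid_apply']
  simp only [map_add, map_sub, map_smul, map_neg, overX_one_arcs_05_12_34, overX_one_arcs_05_14_23,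
    overX_one_arcs_05_13_24, underX_three_arcs_05_14_23]
  module

theorem mid_arcs_05_13_24 :
    mid arcs_05_13_24 = arcs_05_13_24 := by
  rw [mid_apply']
  simp only [map_add, map_sub, map_smul, map_neg, overX_one_arcs_05_14_23,
    underX_three_arcs_05_13_24]

theorem mid_arcs_03_15_24 :
    mid arcs_03_15_24 = (T 1 : ℤ[T;T⁻¹]) • arcs_02_13_45 + (T 1 : ℤ[T;T⁻¹]) • arcs_05_13_24
      - arcs_04_13_25 := by
  rw [mid_apply']
  simp only [map_add, map_sub, map_smul, map_neg, overX_one_arcs_04_15_23,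
    underX_three_arcs_03_15_24]

theorem mid_arcs_04_13_25 :
    mid arcs_04_13_25 = (-T 1 : ℤ[T;T⁻¹]) • arcs_01_24_35 + (-T 1 : ℤ[T;T⁻¹]) • arcs_03_12_45 +
      (T 1 ^ 2 : ℤ[T;T⁻¹]) • arcs_04_12_35 + (T 1 : ℤ[T;T⁻¹]) • arcs_02_15_34 +
      (-T 1 ^ 2 : ℤ[T;T⁻¹]) • arcs_05_14_23 + (T 1 : ℤ[T;T⁻¹]) • arcs_05_13_24 +
      (T 1 : ℤ[T;T⁻¹]) • arcs_03_14_25 + (T 1 : ℤ[T;T⁻¹]) • arcs_04_15_23 - arcs_03_15_24 := by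
  rw [mid_apply']
  simp only [map_add, map_sub, map_smul, map_neg, overX_one_arcs_03_14_25,
    underX_three_arcs_04_13_25]

theorem mid_arcs_03_14_25 :
    mid arcs_03_14_25 = (T 1 : ℤ[T;T⁻¹]) • arcs_01_23_45 + (-T 1 ^ 2 : ℤ[T;T⁻¹]) • arcs_01_24_35 +
      (-T 1 ^ 2 : ℤ[T;T⁻¹]) • arcs_03_12_45 + (T 1 ^ 3 - T 1 : ℤ[T;T⁻¹]) • arcs_04_12_35 +
      (T 1 ^ 2 + T 1 : ℤ[T;T⁻¹]) • arcs_02_15_34 + (-T 1 ^ 3 + T 1 : ℤ[T;T⁻¹]) • arcs_05_14_23 +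
      (T 1 ^ 2 : ℤ[T;T⁻¹]) • arcs_05_13_24 + (-T 1 : ℤ[T;T⁻¹]) • arcs_03_15_24 +
      (-T 1 : ℤ[T;T⁻¹]) • arcs_04_13_25 + (T 1 ^ 2 : ℤ[T;T⁻¹]) • arcs_03_14_25 +
      (T 1 ^ 2 - 1 : ℤ[T;T⁻¹]) • arcs_04_15_23 := by
  rw [mid_apply']
  simp only [map_add, map_sub, map_smul, map_neg, overX_one_arcs_01_25_34, overX_one_arcs_04_13_25,
    overX_one_arcs_03_14_25, underX_three_arcs_03_14_25]
  module

theorem mid_arcs_04_15_23 :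
    mid arcs_04_15_23 = (T 1 : ℤ[T;T⁻¹]) • arcs_02_14_35 + (T 1 : ℤ[T;T⁻¹]) • arcs_05_14_23
      - arcs_03_14_25 := by
  rw [mid_apply]
  simp only [map_add, map_sub, map_smul, map_neg, overX_one_arcs_04_15_23,
    underX_three_arcs_02_13_45, underX_three_arcs_05_13_24, underX_three_arcs_04_13_25]

theorem mid_base :
    mid kanenobuBase = (T 1 ^ 2 : ℤ[T;T⁻¹]) • arcs_01_23_45 +
      (-T 1 ^ 3 - T 1 ^ 2 : ℤ[T;T⁻¹]) • arcs_02_13_45 +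
      (-T 1 ^ 3 - T 1 ^ 2 : ℤ[T;T⁻¹]) • arcs_01_24_35 +
      (T 1 ^ 4 + 2 * T 1 ^ 3 + T 1 ^ 2 : ℤ[T;T⁻¹]) • arcs_02_14_35 +
      (-T 1 ^ 3 + T 1 : ℤ[T;T⁻¹]) • arcs_03_12_45 +
      (T 1 ^ 4 + T 1 ^ 3 - T 1 ^ 2 - T 1 : ℤ[T;T⁻¹]) • arcs_04_12_35 +
      (-T 1 ^ 3 + T 1 : ℤ[T;T⁻¹]) • arcs_01_25_34 +
      (T 1 ^ 4 + T 1 ^ 3 - T 1 ^ 2 - T 1 : ℤ[T;T⁻¹]) • arcs_02_15_34 +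
      (T 1 ^ 4 - 2 * T 1 ^ 2 + 1 : ℤ[T;T⁻¹]) • arcs_05_12_34 := by
  rw [kanenobuBase_eq]
  simp only [map_add, map_sub, map_smul, map_neg, mid_arcs_01_23_45, mid_arcs_02_13_45,
    mid_arcs_01_24_35, mid_arcs_02_14_35, mid_arcs_03_12_45, mid_arcs_04_12_35,
    mid_arcs_01_25_34, mid_arcs_02_15_34, mid_arcs_05_12_34]
  module

theorem underX_two_base :
    underX 2 kanenobuBase = (T 1 ^ 3 : ℤ[T;T⁻¹]) • arcs_01_23_45 +
      (T 1 ^ 3 - T 1 : ℤ[T;T⁻¹]) • arcs_02_13_45 + (T 1 : ℤ[T;T⁻¹]) • arcs_01_24_35 +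
      (-T 1 ^ 2 : ℤ[T;T⁻¹]) • arcs_03_12_45 + arcs_05_13_24 + (-T 1 : ℤ[T;T⁻¹]) • arcs_03_15_24 +
      (-T 1 : ℤ[T;T⁻¹]) • arcs_04_13_25 + (T 1 ^ 2 : ℤ[T;T⁻¹]) • arcs_03_14_25 := by
  rw [kanenobuBase_eq]
  simp only [map_add, map_sub, map_smul, map_neg, underX_two_arcs_01_23_45,
    underX_two_arcs_02_13_45, underX_two_arcs_01_24_35, underX_two_arcs_02_14_35,
    underX_two_arcs_03_12_45, underX_two_arcs_04_12_35, underX_two_arcs_01_25_34,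
        underX_two_arcs_02_15_34, underX_two_arcs_05_12_34]
  module

theorem underX_two_mid_base :
    underX 2 (mid kanenobuBase) =
      (-2 * T 1 ^ 4 - T 1 ^ 3 + 2 * T 1 ^ 2 : ℤ[T;T⁻¹]) • arcs_01_23_45 +
      (-T 1 ^ 4 - 2 * T 1 ^ 3 + T 1 : ℤ[T;T⁻¹]) • arcs_02_13_45 +
      (T 1 ^ 3 - T 1 : ℤ[T;T⁻¹]) • arcs_01_24_35 + (T 1 ^ 3 + T 1 ^ 2 : ℤ[T;T⁻¹]) • arcs_03_12_45 +
      (-T 1 ^ 4 - T 1 ^ 3 : ℤ[T;T⁻¹]) • arcs_01_25_34 +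
      (T 1 ^ 4 - 2 * T 1 ^ 2 + 1 : ℤ[T;T⁻¹]) • arcs_05_13_24 +
      (T 1 ^ 4 + T 1 ^ 3 - T 1 ^ 2 - T 1 : ℤ[T;T⁻¹]) • arcs_03_15_24 +
      (T 1 ^ 4 + T 1 ^ 3 - T 1 ^ 2 - T 1 : ℤ[T;T⁻¹]) • arcs_04_13_25 +
      (T 1 ^ 4 + 2 * T 1 ^ 3 + T 1 ^ 2 : ℤ[T;T⁻¹]) • arcs_03_14_25 := by
  rw [mid_base]
  simp only [map_add, map_sub, map_smul, map_neg, underX_two_arcs_01_23_45,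
    underX_two_arcs_02_13_45, underX_two_arcs_01_24_35, underX_two_arcs_02_14_35,
    underX_two_arcs_03_12_45, underX_two_arcs_04_12_35, underX_two_arcs_01_25_34,
        underX_two_arcs_02_15_34, underX_two_arcs_05_12_34]
  module

theorem mid_underX_two_base :
    mid (underX 2 kanenobuBase) = (T 1 ^ 3 : ℤ[T;T⁻¹]) • arcs_01_23_45 +
      (-T 1 ^ 2 - T 1 : ℤ[T;T⁻¹]) • arcs_02_13_45 +
      (-T 1 ^ 4 - T 1 ^ 3 + T 1 ^ 2 + T 1 : ℤ[T;T⁻¹]) • arcs_01_24_35 +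
      (T 1 ^ 4 + T 1 ^ 3 : ℤ[T;T⁻¹]) • arcs_02_14_35 +
      (-T 1 ^ 4 + T 1 ^ 2 : ℤ[T;T⁻¹]) • arcs_03_12_45 +
      (T 1 ^ 5 + T 1 ^ 4 - 2 * T 1 ^ 3 - 2 * T 1 ^ 2 : ℤ[T;T⁻¹]) • arcs_04_12_35 +
      (T 1 ^ 4 + T 1 ^ 3 : ℤ[T;T⁻¹]) • arcs_02_15_34 +
      (-T 1 ^ 5 + 2 * T 1 ^ 3 : ℤ[T;T⁻¹]) • arcs_05_14_23 +
      (T 1 ^ 4 - 2 * T 1 ^ 2 + 1 : ℤ[T;T⁻¹]) • arcs_05_13_24 +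
      (-T 1 ^ 3 + T 1 : ℤ[T;T⁻¹]) • arcs_03_15_24 + (-T 1 ^ 3 + T 1 : ℤ[T;T⁻¹]) • arcs_04_13_25 +
      (T 1 ^ 4 - T 1 ^ 2 : ℤ[T;T⁻¹]) • arcs_03_14_25 +
      (T 1 ^ 4 - 2 * T 1 ^ 2 : ℤ[T;T⁻¹]) • arcs_04_15_23 := by
  rw [underX_two_base]
  simp only [map_add, map_sub, map_smul, map_neg, mid_arcs_01_23_45, mid_arcs_02_13_45,
    mid_arcs_01_24_35, mid_arcs_03_12_45, mid_arcs_05_13_24, mid_arcs_03_15_24,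
    mid_arcs_04_13_25, mid_arcs_03_14_25]
  module

theorem underX_two_mid_underX_two_base :
    underX 2 (mid (underX 2 kanenobuBase)) =
      (-T 1 ^ 5 + T 1 ^ 3 - T 1 ^ 2 : ℤ[T;T⁻¹]) • arcs_01_23_45 +
      (-T 1 ^ 4 - T 1 ^ 3 : ℤ[T;T⁻¹]) • arcs_02_13_45 +
      (-T 1 ^ 4 + T 1 ^ 2 : ℤ[T;T⁻¹]) • arcs_02_14_35 +
      (T 1 ^ 2 + T 1 : ℤ[T;T⁻¹]) • arcs_03_12_45 + (T 1 ^ 3 - T 1 : ℤ[T;T⁻¹]) • arcs_04_12_35 +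
      (-T 1 ^ 4 - T 1 ^ 3 + T 1 ^ 2 + T 1 : ℤ[T;T⁻¹]) • arcs_01_25_34 +
      (T 1 ^ 3 - T 1 : ℤ[T;T⁻¹]) • arcs_02_15_34 +
      (-T 1 ^ 4 + 2 * T 1 ^ 2 - 1 : ℤ[T;T⁻¹]) • arcs_05_12_34 + (T 1 : ℤ[T;T⁻¹]) • arcs_05_14_23 +
      (T 1 ^ 5 - 2 * T 1 ^ 3 + T 1 : ℤ[T;T⁻¹]) • arcs_05_13_24 +
      (T 1 ^ 3 + T 1 ^ 2 : ℤ[T;T⁻¹]) • arcs_03_15_24 +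
      (T 1 ^ 5 - 2 * T 1 ^ 3 - T 1 ^ 2 : ℤ[T;T⁻¹]) • arcs_04_13_25 +
      (T 1 ^ 5 + T 1 ^ 4 : ℤ[T;T⁻¹]) • arcs_03_14_25 +
      (T 1 ^ 4 - 2 * T 1 ^ 2 : ℤ[T;T⁻¹]) • arcs_04_15_23 := by
  rw [mid_underX_two_base]
  simp only [map_add, map_sub, map_smul, map_neg, underX_two_arcs_01_23_45,
    underX_two_arcs_02_13_45, underX_two_arcs_01_24_35, underX_two_arcs_02_14_35,
    underX_two_arcs_03_12_45, underX_two_arcs_04_12_35, underX_two_arcs_02_15_34,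
        underX_two_arcs_05_14_23, underX_two_arcs_05_13_24, underX_two_arcs_03_15_24,
        underX_two_arcs_04_13_25, underX_two_arcs_03_14_25,
    underX_two_arcs_04_15_23]
  module

/-! ### Closures -/

theorem close_arcs_01_23_45 : close arcs_01_23_45 = unlinkTwo • unlinkTwo • circle := by
  rw [close_apply, cap_four_arcs_01_23_45, map_smul, closeFour_arcs_01_23]

theorem close_arcs_02_13_45 : close arcs_02_13_45 = unlinkTwo • circle := by
  rw [close_apply, cap_four_arcs_02_13_45, map_smul, closeFour_arcs_02_13]

theorem close_arcs_01_24_35 : close arcs_01_24_35 = unlinkTwo • circle := by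
  rw [close_apply, cap_four_arcs_01_24_35, closeFour_arcs_01_23]

theorem close_arcs_02_14_35 : close arcs_02_14_35 = circle := by
  rw [close_apply, cap_four_arcs_02_14_35, closeFour_arcs_02_13]

theorem close_arcs_03_12_45 : close arcs_03_12_45 = unlinkTwo • circle := by
  rw [close_apply, cap_four_arcs_03_12_45, map_smul, closeFour_arcs_03_12]

theorem close_arcs_04_12_35 : close arcs_04_12_35 = circle := by
  rw [close_apply, cap_four_arcs_04_12_35, closeFour_arcs_03_12]

theorem close_arcs_01_25_34 : close arcs_01_25_34 = unlinkTwo • circle := by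
  rw [close_apply, cap_four_arcs_01_25_34, closeFour_arcs_01_23]

theorem close_arcs_02_15_34 : close arcs_02_15_34 = circle := by
  rw [close_apply, cap_four_arcs_02_15_34, closeFour_arcs_02_13]

theorem close_arcs_05_12_34 : close arcs_05_12_34 = circle := by
  rw [close_apply, cap_four_arcs_05_12_34, closeFour_arcs_03_12]

theorem close_arcs_05_14_23 : close arcs_05_14_23 = unlinkTwo • circle := by
  rw [close_apply, cap_four_arcs_05_14_23, closeFour_arcs_01_23]

theorem close_arcs_05_13_24 : close arcs_05_13_24 = circle := by
  rw [close_apply, cap_four_arcs_05_13_24, closeFour_arcs_02_13]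

theorem close_arcs_03_15_24 : close arcs_03_15_24 = circle := by
  rw [close_apply, cap_four_arcs_03_15_24, closeFour_underX_two_arcs_02_13]

theorem close_arcs_04_13_25 : close arcs_04_13_25 = circle := by
  rw [close_apply, cap_four_arcs_04_13_25, closeFour_arcs_02_13]

theorem close_arcs_03_14_25 : close arcs_03_14_25 = circle := by
  rw [close_apply, cap_four_arcs_03_14_25, closeFour_underX_two_arcs_02_13]

theorem close_arcs_04_15_23 : close arcs_04_15_23 = unlinkTwo • circle := by
  rw [close_apply, cap_four_arcs_04_15_23, closeFour_arcs_01_23]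

/-! ### The four initial values of the recursion. -/

theorem mid_mid_base :
    mid (mid kanenobuBase) = (T 1 ^ 4 + 2 * T 1 ^ 3 + T 1 ^ 2 : ℤ[T;T⁻¹]) • arcs_01_23_45 +
      (-T 1 ^ 5 - 2 * T 1 ^ 4 + T 1 ^ 2 : ℤ[T;T⁻¹]) • arcs_02_13_45 +
      (-T 1 ^ 5 - 2 * T 1 ^ 4 + T 1 ^ 2 : ℤ[T;T⁻¹]) • arcs_01_24_35 +
      (T 1 ^ 6 + 2 * T 1 ^ 5 - T 1 ^ 4 - 2 * T 1 ^ 3 + T 1 ^ 2 : ℤ[T;T⁻¹]) • arcs_02_14_35 +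
      (-T 1 ^ 5 - 3 * T 1 ^ 4 - 2 * T 1 ^ 3 + T 1 ^ 2 + T 1 : ℤ[T;T⁻¹]) • arcs_03_12_45 +
      (T 1 ^ 6 + 3 * T 1 ^ 5 + T 1 ^ 4 - 3 * T 1 ^ 3 - T 1 ^ 2 + T 1 : ℤ[T;T⁻¹]) • arcs_04_12_35 +
      (-T 1 ^ 5 - 3 * T 1 ^ 4 - 2 * T 1 ^ 3 + T 1 ^ 2 + T 1 : ℤ[T;T⁻¹]) • arcs_01_25_34 +
      (T 1 ^ 6 + 3 * T 1 ^ 5 + T 1 ^ 4 - 3 * T 1 ^ 3 - T 1 ^ 2 + T 1 : ℤ[T;T⁻¹]) • arcs_02_15_34 +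
      (T 1 ^ 6 + 4 * T 1 ^ 5 + 4 * T 1 ^ 4 - 2 * T 1 ^ 3 - 4 * T 1 ^ 2 +
        1 : ℤ[T;T⁻¹]) • arcs_05_12_34 := by
  rw [mid_base]
  simp only [map_add, map_sub, map_smul, map_neg, mid_arcs_01_23_45, mid_arcs_02_13_45,
    mid_arcs_01_24_35, mid_arcs_02_14_35, mid_arcs_03_12_45, mid_arcs_04_12_35,
    mid_arcs_01_25_34, mid_arcs_02_15_34, mid_arcs_05_12_34]
  module

/-- The coefficient is the square of `2x³ + 4x² - 2x - 3`, the `Q`-polynomial of the figure eight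
knot: `K(0, 0)` is the sum of that knot and its mirror image. -/
theorem close_zero_zero : close (mid (mid kanenobuBase)) =
    (4 * T 1 ^ 6 + 16 * T 1 ^ 5 + 8 * T 1 ^ 4 - 28 * T 1 ^ 3 - 20 * T 1 ^ 2 + 12 * T 1 +
        9 : ℤ[T;T⁻¹]) • circle := by
  rw [mid_mid_base]
  simp only [map_add, map_sub, map_smul, map_neg, close_arcs_01_23_45, close_arcs_02_13_45,
    close_arcs_01_24_35, close_arcs_02_14_35,
    close_arcs_03_12_45, close_arcs_04_12_35, close_arcs_01_25_34, close_arcs_02_15_34,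
        close_arcs_05_12_34]
  match_scalars
  -- Both sides are polynomials in `x` and `δ` that agree modulo `xδ = 2 - x`; the cofactor is the
  -- quotient of this reduction.
  linear_combination (-4 * T 1 ^ 4 + T 1 ^ 3 * unlinkTwo - 11 * T 1 ^ 3 + 2 * T 1 ^ 2 * unlinkTwo
      - 4 * T 1 ^ 2
    + T 1 * unlinkTwo + 7 * T 1 + 4) * T_mul_unlinkTwo

theorem mid_underX_two_mid_base :
    mid (underX 2 (mid kanenobuBase)) =
      (T 1 ^ 5 + 2 * T 1 ^ 4 + T 1 ^ 3 : ℤ[T;T⁻¹]) • arcs_01_23_45 +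
      (T 1 ^ 5 + T 1 ^ 4 - 2 * T 1 ^ 3 - T 1 ^ 2 + T 1 : ℤ[T;T⁻¹]) • arcs_02_13_45 +
      (-T 1 ^ 6 - 3 * T 1 ^ 5 - T 1 ^ 4 + 3 * T 1 ^ 3 + T 1 ^ 2 - T 1 : ℤ[T;T⁻¹]) • arcs_01_24_35 +
      (-T 1 ^ 5 - 3 * T 1 ^ 4 - T 1 ^ 3 + 2 * T 1 ^ 2 : ℤ[T;T⁻¹]) • arcs_02_14_35 +
      (-T 1 ^ 6 - 3 * T 1 ^ 5 - 2 * T 1 ^ 4 + T 1 ^ 3 + T 1 ^ 2 : ℤ[T;T⁻¹]) • arcs_03_12_45 +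
      (T 1 ^ 7 + 3 * T 1 ^ 6 - 5 * T 1 ^ 4 - T 1 ^ 3 + 2 * T 1 ^ 2 : ℤ[T;T⁻¹]) • arcs_04_12_35 +
      (T 1 ^ 6 + 4 * T 1 ^ 5 + 4 * T 1 ^ 4 - T 1 ^ 3 - 2 * T 1 ^ 2 : ℤ[T;T⁻¹]) • arcs_02_15_34 +
      (-T 1 ^ 7 - 3 * T 1 ^ 6 - T 1 ^ 5 + 3 * T 1 ^ 4 + 2 * T 1 ^ 3 : ℤ[T;T⁻¹]) • arcs_05_14_23 +
      (T 1 ^ 6 + 4 * T 1 ^ 5 + 4 * T 1 ^ 4 - 2 * T 1 ^ 3 - 4 * T 1 ^ 2 +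
        1 : ℤ[T;T⁻¹]) • arcs_05_13_24 +
      (-T 1 ^ 5 - 3 * T 1 ^ 4 - 2 * T 1 ^ 3 + T 1 ^ 2 + T 1 : ℤ[T;T⁻¹]) • arcs_03_15_24 +
      (-T 1 ^ 5 - 3 * T 1 ^ 4 - 2 * T 1 ^ 3 + T 1 ^ 2 + T 1 : ℤ[T;T⁻¹]) • arcs_04_13_25 +
      (T 1 ^ 6 + 3 * T 1 ^ 5 + 2 * T 1 ^ 4 - T 1 ^ 3 - T 1 ^ 2 : ℤ[T;T⁻¹]) • arcs_03_14_25 +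
      (T 1 ^ 6 + 3 * T 1 ^ 5 + T 1 ^ 4 - 3 * T 1 ^ 3 - 2 * T 1 ^ 2 : ℤ[T;T⁻¹]) • arcs_04_15_23 := by
  rw [underX_two_mid_base]
  simp only [map_add, map_sub, map_smul, map_neg, mid_arcs_01_23_45, mid_arcs_02_13_45,
    mid_arcs_01_24_35, mid_arcs_03_12_45, mid_arcs_01_25_34, mid_arcs_05_13_24,
    mid_arcs_03_15_24, mid_arcs_04_13_25, mid_arcs_03_14_25]
  module

theorem close_one_zero : close (mid (underX 2 (mid kanenobuBase))) =
    (2 * T 1 ^ 7 + 8 * T 1 ^ 6 + 4 * T 1 ^ 5 - 14 * T 1 ^ 4 - 10 * T 1 ^ 3 + 6 * T 1 ^ 2 +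
        4 * T 1 + 1 : ℤ[T;T⁻¹]) • circle := by
  rw [mid_underX_two_mid_base]
  simp only [map_add, map_sub, map_smul, map_neg, close_arcs_01_23_45, close_arcs_02_13_45,
    close_arcs_01_24_35, close_arcs_02_14_35,
    close_arcs_03_12_45, close_arcs_04_12_35, close_arcs_02_15_34, close_arcs_05_14_23,
        close_arcs_05_13_24, close_arcs_03_15_24, close_arcs_04_13_25, close_arcs_03_14_25,
        close_arcs_04_15_23]
  match_scalars
  linear_combination (-T 1 ^ 6 - 4 * T 1 ^ 5 + T 1 ^ 4 * unlinkTwo - 4 * T 1 ^ 4 + 2 * T 1 ^ 3 *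
      unlinkTwo + 2 *
    T 1 ^ 3 + T 1 ^ 2 * unlinkTwo + 4 * T 1 ^ 2 + T 1) * T_mul_unlinkTwo

theorem mid_mid_underX_two_base :
    mid (mid (underX 2 kanenobuBase)) = (T 1 ^ 5 + T 1 ^ 4 : ℤ[T;T⁻¹]) • arcs_01_23_45 +
      (-T 1 ^ 5 - T 1 ^ 4 + T 1 ^ 3 - T 1 : ℤ[T;T⁻¹]) • arcs_02_13_45 +
      (-T 1 ^ 6 - T 1 ^ 5 + T 1 ^ 4 + T 1 : ℤ[T;T⁻¹]) • arcs_01_24_35 +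
      (T 1 ^ 6 + T 1 ^ 5 - T 1 ^ 4 - T 1 ^ 3 : ℤ[T;T⁻¹]) • arcs_02_14_35 +
      (-T 1 ^ 6 - 2 * T 1 ^ 5 + 2 * T 1 ^ 3 + T 1 ^ 2 : ℤ[T;T⁻¹]) • arcs_03_12_45 +
      (T 1 ^ 7 + 2 * T 1 ^ 6 - T 1 ^ 5 - 3 * T 1 ^ 4 - T 1 ^ 3 : ℤ[T;T⁻¹]) • arcs_04_12_35 +
      (-T 1 ^ 5 - 2 * T 1 ^ 4 - T 1 ^ 3 : ℤ[T;T⁻¹]) • arcs_01_25_34 +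
      (2 * T 1 ^ 6 + 2 * T 1 ^ 5 - 2 * T 1 ^ 4 + 2 * T 1 ^ 2 : ℤ[T;T⁻¹]) • arcs_02_15_34 +
      (2 * T 1 ^ 6 + 3 * T 1 ^ 5 - T 1 ^ 4 - 2 * T 1 ^ 3 : ℤ[T;T⁻¹]) • arcs_05_12_34 +
      (-T 1 ^ 7 + 3 * T 1 ^ 5 - 2 * T 1 ^ 3 : ℤ[T;T⁻¹]) • arcs_05_14_23 +
      (T 1 ^ 6 - 2 * T 1 ^ 4 + 1 : ℤ[T;T⁻¹]) • arcs_05_13_24 +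
      (-T 1 ^ 5 + 2 * T 1 ^ 3 - T 1 : ℤ[T;T⁻¹]) • arcs_03_15_24 +
      (-T 1 ^ 5 + 2 * T 1 ^ 3 - T 1 : ℤ[T;T⁻¹]) • arcs_04_13_25 +
      (T 1 ^ 6 - 3 * T 1 ^ 4 + 3 * T 1 ^ 2 : ℤ[T;T⁻¹]) • arcs_03_14_25 +
      (T 1 ^ 6 - 3 * T 1 ^ 4 + 2 * T 1 ^ 2 : ℤ[T;T⁻¹]) • arcs_04_15_23 := by
  rw [mid_underX_two_base]
  simp only [map_add, map_sub, map_smul, map_neg, mid_arcs_01_23_45, mid_arcs_02_13_45,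
    mid_arcs_01_24_35, mid_arcs_02_14_35, mid_arcs_03_12_45, mid_arcs_04_12_35,
    mid_arcs_02_15_34, mid_arcs_05_14_23, mid_arcs_05_13_24, mid_arcs_03_15_24, mid_arcs_04_13_25,
        mid_arcs_03_14_25, mid_arcs_04_15_23]
  module

theorem close_zero_one : close (mid (mid (underX 2 kanenobuBase))) =
    (2 * T 1 ^ 7 + 8 * T 1 ^ 6 + 4 * T 1 ^ 5 - 14 * T 1 ^ 4 - 10 * T 1 ^ 3 + 6 * T 1 ^ 2 +
        4 * T 1 + 1 : ℤ[T;T⁻¹]) • circle := by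
  rw [mid_mid_underX_two_base]
  simp only [map_add, map_sub, map_smul, map_neg, close_arcs_01_23_45, close_arcs_02_13_45,
    close_arcs_01_24_35, close_arcs_02_14_35,
    close_arcs_03_12_45, close_arcs_04_12_35, close_arcs_01_25_34, close_arcs_02_15_34,
        close_arcs_05_12_34, close_arcs_05_14_23, close_arcs_05_13_24, close_arcs_03_15_24,
        close_arcs_04_13_25,
    close_arcs_03_14_25, close_arcs_04_15_23]
  match_scalars
  linear_combination (-T 1 ^ 6 - T 1 ^ 5 + T 1 ^ 4 * unlinkTwo - 3 * T 1 ^ 4 + T 1 ^ 3 * unlinkTwo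
      - 4 * T 1 ^ 3
    + 2 * T 1 ^ 2 + 3 * T 1) * T_mul_unlinkTwo

theorem mid_underX_two_mid_underX_two_base :
    mid (underX 2 (mid (underX 2 kanenobuBase))) =
      (T 1 ^ 6 + T 1 ^ 5 - T 1 ^ 4 + T 1 ^ 2 : ℤ[T;T⁻¹]) • arcs_01_23_45 +
      (T 1 ^ 5 + T 1 ^ 4 : ℤ[T;T⁻¹]) • arcs_02_13_45 +
      (-T 1 ^ 7 - 2 * T 1 ^ 6 + T 1 ^ 5 + 3 * T 1 ^ 4 + T 1 ^ 3 : ℤ[T;T⁻¹]) • arcs_01_24_35 +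
      (-T 1 ^ 6 - T 1 ^ 5 - T 1 ^ 3 - T 1 ^ 2 : ℤ[T;T⁻¹]) • arcs_02_14_35 +
      (-T 1 ^ 7 - 2 * T 1 ^ 6 + T 1 ^ 5 + 2 * T 1 ^ 4 - T 1 ^ 3 + T 1 : ℤ[T;T⁻¹]) • arcs_03_12_45 +
      (T 1 ^ 8 + 2 * T 1 ^ 7 - 2 * T 1 ^ 6 - 4 * T 1 ^ 5 + T 1 : ℤ[T;T⁻¹]) • arcs_04_12_35 +
      (T 1 ^ 5 - 2 * T 1 ^ 3 + T 1 : ℤ[T;T⁻¹]) • arcs_01_25_34 +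
      (T 1 ^ 7 + 2 * T 1 ^ 6 + T 1 ^ 5 - T 1 ^ 4 - 2 * T 1 ^ 3 + T 1 : ℤ[T;T⁻¹]) • arcs_02_15_34 +
      (-T 1 ^ 6 + 2 * T 1 ^ 4 - 1 : ℤ[T;T⁻¹]) • arcs_05_12_34 +
      (-T 1 ^ 8 - 2 * T 1 ^ 7 + T 1 ^ 6 + 4 * T 1 ^ 5 + T 1 ^ 4 - 2 * T 1 ^ 3 +
        T 1 : ℤ[T;T⁻¹]) • arcs_05_14_23 +
      (T 1 ^ 7 + 2 * T 1 ^ 6 + T 1 ^ 5 - T 1 ^ 4 - 2 * T 1 ^ 3 + T 1 : ℤ[T;T⁻¹]) • arcs_05_13_24 +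
      (-T 1 ^ 6 - 2 * T 1 ^ 5 + 2 * T 1 ^ 3 + T 1 ^ 2 : ℤ[T;T⁻¹]) • arcs_03_15_24 +
      (-T 1 ^ 6 - T 1 ^ 5 - T 1 ^ 3 - T 1 ^ 2 : ℤ[T;T⁻¹]) • arcs_04_13_25 +
      (T 1 ^ 7 + 2 * T 1 ^ 6 - 3 * T 1 ^ 4 - T 1 ^ 3 + 2 * T 1 ^ 2 : ℤ[T;T⁻¹]) • arcs_03_14_25 +
      (T 1 ^ 7 + 2 * T 1 ^ 6 - T 1 ^ 5 - 3 * T 1 ^ 4 - T 1 ^ 3 : ℤ[T;T⁻¹]) • arcs_04_15_23 := by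
  rw [underX_two_mid_underX_two_base]
  simp only [map_add, map_sub, map_smul, map_neg, mid_arcs_01_23_45, mid_arcs_02_13_45,
    mid_arcs_02_14_35, mid_arcs_03_12_45, mid_arcs_04_12_35, mid_arcs_01_25_34,
    mid_arcs_02_15_34, mid_arcs_05_12_34, mid_arcs_05_14_23, mid_arcs_05_13_24, mid_arcs_03_15_24,
        mid_arcs_04_13_25, mid_arcs_03_14_25, mid_arcs_04_15_23]
  module

theorem close_one_one : close (mid (underX 2 (mid (underX 2 kanenobuBase)))) =
    (2 * T 1 ^ 8 + 6 * T 1 ^ 7 - 4 * T 1 ^ 6 - 18 * T 1 ^ 5 + 6 * T 1 ^ 4 + 16 * T 1 ^ 3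
        - 12 * T 1 ^ 2 - 4 * T 1 + 9 : ℤ[T;T⁻¹]) • circle := by
  rw [mid_underX_two_mid_underX_two_base]
  simp only [map_add, map_sub, map_smul, map_neg, close_arcs_01_23_45, close_arcs_02_13_45,
    close_arcs_01_24_35, close_arcs_02_14_35,
    close_arcs_03_12_45, close_arcs_04_12_35, close_arcs_01_25_34, close_arcs_02_15_34,
        close_arcs_05_12_34, close_arcs_05_14_23, close_arcs_05_13_24, close_arcs_03_15_24,
        close_arcs_04_13_25,
    close_arcs_03_14_25, close_arcs_04_15_23]
  match_scalars
  linear_combination (-T 1 ^ 7 - 3 * T 1 ^ 6 + T 1 ^ 5 * unlinkTwo - 2 * T 1 ^ 5 + T 1 ^ 4 *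
      unlinkTwo + 8 * T 1
    ^ 4 - T 1 ^ 3 * unlinkTwo + 7 * T 1 ^ 3 - 7 * T 1 ^ 2 + T 1 * unlinkTwo - T 1 + 5) *
        T_mul_unlinkTwo

end Ket

/-! ## The skein class of `K(p, q)` -/

namespace Ket

/-- A half twist on the axis of the diagrams of the Kanenobu knots. -/
noncomputable def twist : (Module.End ℤ[T;T⁻¹] Ket6)ˣ where
  val := underX 2
  inv := overX 2
  val_inv := LinearMap.ext fun k => underX_overX k (by omega)
  inv_val := LinearMap.ext fun k => overX_underX k (by omega)

/-- `K(p, q)` as an element of the space of tangles without endpoints. -/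
noncomputable def kanenobu (p q : ℤ) : Ket 0 :=
  close (mid ((twist ^ p).val (mid ((twist ^ q).val kanenobuBase))))

theorem pow_apply_replicate (f : Module.End ℤ[T;T⁻¹] Ket6) (l : Layer)
    (hf : ∀ k v, (f k).1 v = k.1 (l :: v)) (n : ℕ) (k : Ket6) (v : List Layer) :
    ((f ^ n) k).1 v = k.1 (List.replicate n l ++ v) := by
  induction n generalizing k with
  | zero => rfl
  | succ n ih =>
    rw [pow_succ, Module.End.mul_apply, ih, hf, List.replicate_succ, List.cons_append]

theorem twist_zpow_apply (p : ℤ) (k : Ket6) (v : List Layer) :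
    ((twist ^ p).val k).1 v = k.1 (halfTwists 2 p ++ v) := by
  unfold halfTwists
  split_ifs with hp
  · lift p to ℕ using hp
    rw [zpow_natCast, Units.val_pow_eq_pow_val]
    exact pow_apply_replicate _ (underAt 2) (fun _ _ => rfl) p k v
  · obtain ⟨n, rfl⟩ : ∃ n : ℕ, p = -n := ⟨p.natAbs, by omega⟩
    rw [zpow_neg, zpow_natCast, ← inv_pow, Units.val_pow_eq_pow_val, Int.natAbs_neg,
      Int.natAbs_natCast]
    exact pow_apply_replicate _ (overAt 2) (fun _ _ => rfl) n k v

theorem kanenobu_apply_nil (p q : ℤ) : (kanenobu p q).1 [] = (kanenobuKnot p q).skein := by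
  rw [kanenobuKnot, ← wordSkein_of_width]
  change ((twist ^ p).val (mid ((twist ^ q).val kanenobuBase))).1
    [overAt 1, underAt 3, capAt 4, capAt 2, capAt 0] = _
  rw [twist_zpow_apply]
  change ((twist ^ q).val kanenobuBase).1 ([overAt 1, underAt 3] ++ _) = _
  rw [twist_zpow_apply]
  change wordSkein _ = _
  congr 1
  simp [kanenobuWord]

theorem circle_apply_nil : circle.1 [] = unknot.skein := by
  rw [unknot, ← wordSkein_of_width]
  rfl

/-! ### The smoothed diagrams and the recursions in `p` and `q`. -/

theorem cap_two_twist_zpow (n : ℤ) (k : Ket6) : cap 2 ((twist ^ n).val k) = cap 2 k := by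
  have h : ∀ k, cap 2 (twist.val k) = cap 2 k := fun k => cap_underX k 2
  induction n using Int.induction_on with
  | zero => rfl
  | succ n ih => rw [add_comm (n : ℤ) 1, zpow_add, zpow_one, Units.val_mul, Module.End.mul_apply,
      h, ih]
  | pred n ih =>
    rw [← ih, ← h]
    conv_rhs => rw [show (-(n : ℤ)) = 1 + (-n - 1) by ring, zpow_add, zpow_one, Units.val_mul,
      Module.End.mul_apply]

theorem twist_zpow_cup_two (n : ℤ) (k : Ket (0 + 2 + 2)) :
    (twist ^ n).val (cup 2 k) = cup 2 k := by
  have h : twist.val (cup 2 k) = cup 2 k := underX_cup k 2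
  induction n using Int.induction_on with
  | zero => rfl
  | succ n ih => rw [zpow_add, zpow_one, Units.val_mul, Module.End.mul_apply, h, ih]
  | pred n ih =>
    conv_lhs => rw [← h, ← Module.End.mul_apply, ← Units.val_mul, ← zpow_add_one, sub_add_cancel,
        ih]

/-- The smoothed term is independent of `n`, since the remaining half twists become kinks. -/
theorem twist_zpow_recursion (n : ℤ) (k : Ket6) :
    (twist ^ (n + 1)).val k + (twist ^ (n - 1)).val k =
      (T 1 : ℤ[T;T⁻¹]) • ((twist ^ n).val k + cup 2 (cap 2 k)) := by
  rw [← cap_two_twist_zpow n k, ← overX_add_underX _ (by omega), add_comm n 1, zpow_add,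
    sub_eq_neg_add, zpow_add, zpow_one, zpow_neg_one, Units.val_mul, Units.val_mul, add_comm]
  rfl

/-- Three nested local maxima. -/
noncomputable def nest : Ket6 →ₗ[ℤ[T;T⁻¹]] Ket 0 := cap 0 ∘ₗ cap 1 ∘ₗ cap 2

theorem nest_apply (k : Ket6) : nest k = cap 0 (cap 1 (cap 2 k)) := rfl

/-- The nested maxima join strands 1 and 2 to strands 4 and 3, so the crossing slides along the two
parallel arcs to the other side. There it cancels the `underX 3` of `mid`. -/
theorem nest_overX_one (k : Ket6) : nest (overX 1 k) = nest (overX 3 k) := by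
  have h1 : cap 2 (overX 1 k) = cap 1 (underX 2 k) := cap_succ_overX k 1
  have h2 : cap 3 (underX 2 k) = cap 2 (overX 3 k) := cap_succ_underX k 2
  rw [nest_apply, nest_apply, h1, cap_cap (i := 1) (j := 1) _ le_rfl, h2]

theorem nest_mid (k : Ket6) : nest (mid k) = nest k := by
  rw [mid_apply', nest_overX_one, overX_underX _ (by omega)]

theorem nest_twist_zpow (n : ℤ) (k : Ket6) : nest ((twist ^ n).val k) = nest k := by
  rw [nest_apply, cap_two_twist_zpow, nest_apply]

theorem nest_overX_four (k : Ket6) : nest (overX 4 k) = nest (overX 0 k) := by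
  have h1 (z : Ket (0 + 2 + 2)) : cap 1 (overX 0 z) = cap 0 (underX 1 z) := cap_succ_overX z 0
  have h2 (z : Ket (0 + 2 + 2)) : cap 2 (underX 1 z) = cap 1 (overX 2 z) := cap_succ_underX z 1
  rw [nest_apply, nest_apply, cap_overX_right (i := 2) (j := 2) _ le_rfl,
    cap_overX_left (j := 2) _ (by omega), h1, cap_cap (i := 0) (j := 0) _ le_rfl, h2]

theorem nest_arcs_01_23_45 : nest arcs_01_23_45 = unlinkTwo • circle := by
  rw [nest_apply, ← cup_two_arcs_01_23, cap_cup_of_pos _ (by omega), map_smul, map_smul, arcs_01_23,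
    cap_cup_succ _ (by omega), circle]

/-- All four crossings cancel in pairs under the nested maxima, leaving two disjoint circles. -/
theorem nest_base : nest kanenobuBase = unlinkTwo • circle := by
  rw [kanenobuBase, nest_overX_four, overX_underX _ (by omega), ← mid_apply, nest_mid,
    nest_arcs_01_23_45]

/-- After a smoothing in the upper column the two crossings above it slide along the maxima and
cancel; together with the maximum of the smoothing this yields `nest`. -/
theorem close_mid_cup_two (k : Ket (0 + 2 + 2)) : close (mid (cup 2 k)) = cap 0 (cap 1 k) := by
  have h1 (z : Ket6) : cap 4 (underX 3 z) = cap 3 (overX 4 z) := cap_succ_underX z 3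
  have h2 (z : Ket (0 + 2 + 2)) : cap 2 (overX 1 z) = cap 1 (underX 2 z) := cap_succ_overX z 1
  rw [mid_apply', close_apply, cap_overX_left (j := 4) _ (by omega), h1,
    overX_cup_right (i := 2) (j := 2) _ le_rfl, cap_succ_cup _ (by omega), closeFour,
    LinearMap.comp_apply, h2, underX_overX _ (by omega)]

/-- Joining the two middle strands lets all crossings of the base untwist. -/
theorem cap_two_base : cap 2 kanenobuBase = arcs_03_12 := by
  rw [kanenobuBase, cap_overX_right (i := 2) (j := 2) _ le_rfl,
    cap_underX_left (j := 2) _ (by omega), overX_one_arcs_01_23_45, underX_three_arcs_02_13_45,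
        cap_two_arcs_02_14_35, underX_zero_arcs_03_12,
    ← underX_two_arcs_03_12, overX_underX _ (by omega)]

/-- A smoothing in the lower column leaves three nested minima, a tangle fixed both by `mid` and by
the half twists. -/
theorem close_mid_twist_mid_cup_two_base (p : ℤ) :
    close (mid ((twist ^ p).val (mid (cup 2 (cap 2 kanenobuBase))))) = unlinkTwo • circle := by
  have h : mid arcs_05_14_23 = arcs_05_14_23 := by rw [mid_apply, overX_one_arcs_05_14_23,
      underX_three_arcs_05_13_24]
  rw [cap_two_base, ← arcs_05_14_23, h, arcs_05_14_23, twist_zpow_cup_two, ← arcs_05_14_23, h,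
    close_arcs_05_14_23]

theorem kanenobu_recursion_left (p q : ℤ) : kanenobu (p + 1) q + kanenobu (p - 1) q =
    (T 1 : ℤ[T;T⁻¹]) • (kanenobu p q + unlinkTwo • circle) := by
  unfold kanenobu
  rw [← map_add, ← map_add, twist_zpow_recursion, map_smul, map_smul, map_add, map_add,
    close_mid_cup_two, ← nest_apply, nest_mid, nest_twist_zpow, nest_base]

theorem kanenobu_recursion_right (p q : ℤ) : kanenobu p (q + 1) + kanenobu p (q - 1) =
    (T 1 : ℤ[T;T⁻¹]) • (kanenobu p q + unlinkTwo • circle) := by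
  unfold kanenobu
  rw [← map_add, ← map_add, ← map_add, ← map_add, twist_zpow_recursion]
  simp only [map_smul, map_add]
  rw [close_mid_twist_mid_cup_two_base]

theorem kanenobu_zero_zero : kanenobu 0 0 = (4 * T 1 ^ 6 + 16 * T 1 ^ 5 + 8 * T 1 ^ 4 -
    28 * T 1 ^ 3 - 20 * T 1 ^ 2 + 12 * T 1 + 9 : ℤ[T;T⁻¹]) • circle := close_zero_zero

theorem kanenobu_one_zero : kanenobu 1 0 = (2 * T 1 ^ 7 + 8 * T 1 ^ 6 + 4 * T 1 ^ 5 -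
    14 * T 1 ^ 4 - 10 * T 1 ^ 3 + 6 * T 1 ^ 2 + 4 * T 1 + 1 : ℤ[T;T⁻¹]) • circle := by
  rw [kanenobu, zpow_one]
  exact close_one_zero

theorem kanenobu_zero_one : kanenobu 0 1 = (2 * T 1 ^ 7 + 8 * T 1 ^ 6 + 4 * T 1 ^ 5 -
    14 * T 1 ^ 4 - 10 * T 1 ^ 3 + 6 * T 1 ^ 2 + 4 * T 1 + 1 : ℤ[T;T⁻¹]) • circle := by
  rw [kanenobu, zpow_one]
  exact close_zero_one

theorem kanenobu_one_one : kanenobu 1 1 = (2 * T 1 ^ 8 + 6 * T 1 ^ 7 - 4 * T 1 ^ 6 -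
    18 * T 1 ^ 5 + 6 * T 1 ^ 4 + 16 * T 1 ^ 3 - 12 * T 1 ^ 2 - 4 * T 1 + 9 : ℤ[T;T⁻¹]) •
      circle := by
  rw [kanenobu, zpow_one]
  exact close_one_one

end Ket

/-! ## Sequences with the recursion of the Chebyshev polynomials -/

section Chebyshev

open Polynomial

/-- The sequence of polynomials with the recursion `u (n + 1) + u (n - 1) = X * u n` and the given
values at `0` and `1`. -/
noncomputable def chebyshevSeq (u₀ u₁ : ℤ[X]) (n : ℤ) : ℤ[X] :=
  Chebyshev.S ℤ (n - 1) * u₁ - Chebyshev.S ℤ (n - 2) * u₀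

variable (u₀ u₁ : ℤ[X])

theorem chebyshevSeq_recursion (n : ℤ) :
    chebyshevSeq u₀ u₁ (n + 1) + chebyshevSeq u₀ u₁ (n - 1) = X * chebyshevSeq u₀ u₁ n := by
  have h1 := Chebyshev.S_add_two ℤ (n - 2)
  have h2 := Chebyshev.S_add_two ℤ (n - 3)
  rw [show n - 2 + 2 = n by ring, show n - 2 + 1 = n - 1 by ring] at h1
  rw [show n - 3 + 2 = n - 1 by ring, show n - 3 + 1 = n - 2 by ring] at h2
  simp only [chebyshevSeq]
  rw [show n + 1 - 1 = n by ring, show n + 1 - 2 = n - 1 by ring, show n - 1 - 1 = n - 2 by ring,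
    show n - 1 - 2 = n - 3 by ring, h1]
  linear_combination -u₀ * h2

theorem chebyshevSeq_zero : chebyshevSeq u₀ u₁ 0 = u₀ := by
  simp [chebyshevSeq]

theorem chebyshevSeq_one : chebyshevSeq u₀ u₁ 1 = u₁ := by
  simp [chebyshevSeq]

theorem eq_of_chebyshev_recursion {R M : Type*} [Ring R] [AddCommGroup M] [Module R M] (x : R)
    {u v : ℤ → M} (hu : ∀ n, u (n + 1) + u (n - 1) = x • u n)
    (hv : ∀ n, v (n + 1) + v (n - 1) = x • v n) (h0 : u 0 = v 0) (h1 : u 1 = v 1) (n : ℤ) :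
    u n = v n := by
  suffices u n = v n ∧ u (n + 1) = v (n + 1) from this.1
  induction n using Int.induction_on with
  | zero => exact ⟨h0, by simpa using h1⟩
  | succ n ih =>
    refine ⟨ih.2, ?_⟩
    have a := hu (n + 1)
    have b := hv (n + 1)
    rw [add_sub_cancel_right, ih.1, ih.2, ← b, add_sub_cancel_right] at a
    exact add_right_cancel a
  | pred n ih =>
    rw [sub_add_cancel]
    refine ⟨?_, ih.1⟩
    have a := hu (-n)
    have b := hv (-n)
    rw [ih.1, ih.2, ← b] at a
    exact add_left_cancel a

/-- A weak inequality at the start suffices: `X * u (n + 1)` then has larger degree than `u n`, so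
nothing cancels in the leading term. -/
theorem natDegree_of_chebyshev_recursion {u : ℕ → ℤ[X]}
    (hu : ∀ n, u (n + 2) = X * u (n + 1) - u n) (h : (u 0).natDegree ≤ (u 1).natDegree)
    (h1 : u 1 ≠ 0) (n : ℕ) : (u (n + 1)).natDegree = (u 1).natDegree + n := by
  suffices (u n).natDegree ≤ (u (n + 1)).natDegree ∧ u (n + 1) ≠ 0 ∧
    (u (n + 1)).natDegree = (u 1).natDegree + n from this.2.2
  induction n with
  | zero => exact ⟨h, h1, rfl⟩
  | succ n ih =>
    obtain ⟨ih1, ih2, ih3⟩ := ih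
    have hX : (X * u (n + 1)).natDegree = (u (n + 1)).natDegree + 1 := natDegree_X_mul ih2
    have hd : (u (n + 1 + 1)).natDegree = (u (n + 1)).natDegree + 1 := by
      rw [show n + 1 + 1 = n + 2 from rfl, hu, natDegree_sub_eq_left_of_natDegree_lt (by omega), hX]
    refine ⟨by omega, fun h0 => ?_, by omega⟩
    rw [h0, natDegree_zero] at hd
    omega

end Chebyshev

/-! ## The degree of the `Q`-polynomial of `K(p, q)` -/

section Degree

open Polynomial

/-- Half of `Q(0, 0) - 1`. -/
noncomputable def kanenobuPolyA : ℤ[X] :=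
  2 * X ^ 6 + 8 * X ^ 5 + 4 * X ^ 4 - 14 * X ^ 3 - 10 * X ^ 2 + 6 * X + 4

/-- `Q(1, 1) - 1`. -/
noncomputable def kanenobuPolyB : ℤ[X] :=
  2 * X ^ 8 + 6 * X ^ 7 - 4 * X ^ 6 - 18 * X ^ 5 + 6 * X ^ 4 + 16 * X ^ 3 - 12 * X ^ 2 - 4 * X + 8

theorem natDegree_kanenobuPolyB : kanenobuPolyB.natDegree = 8 := by
  unfold kanenobuPolyB
  compute_degree!

theorem natDegree_two_mul_kanenobuPolyA : (2 * kanenobuPolyA).natDegree = 6 := by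
  unfold kanenobuPolyA
  compute_degree!

theorem natDegree_X_mul_kanenobuPolyA : (X * kanenobuPolyA).natDegree = 7 := by
  unfold kanenobuPolyA
  compute_degree!

/-- This is the value at `(1, -1)`. Both terms lead with `2 X ^ 8`, and their cancellation causes
the smaller degree for `pq < 0`. -/
theorem natDegree_sub_kanenobuPolyB : (X * (X * kanenobuPolyA) - kanenobuPolyB).natDegree = 7 := by
  have h : X * (X * kanenobuPolyA) - kanenobuPolyB = 2 * X ^ 7 + 8 * X ^ 6 + 4 * X ^ 5 -
      16 * X ^ 4 - 10 * X ^ 3 + 16 * X ^ 2 + 4 * X - 8 := by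
    unfold kanenobuPolyA kanenobuPolyB
    ring
  rw [h]
  compute_degree!

/-- `Q(p, q) - 1`. -/
noncomputable def kanenobuPoly (p q : ℤ) : ℤ[X] :=
  chebyshevSeq (chebyshevSeq (2 * kanenobuPolyA) (X * kanenobuPolyA) q)
    (chebyshevSeq (X * kanenobuPolyA) kanenobuPolyB q) p

theorem kanenobuPoly_recursion_left (p q : ℤ) :
    kanenobuPoly (p + 1) q + kanenobuPoly (p - 1) q = X * kanenobuPoly p q :=
  chebyshevSeq_recursion _ _ p

/-- For fixed `p` the polynomial is a combination of two solutions in `q`, with coefficients that do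
not depend on `q`. -/
theorem kanenobuPoly_recursion_right (p q : ℤ) :
    kanenobuPoly p (q + 1) + kanenobuPoly p (q - 1) = X * kanenobuPoly p q := by
  have h1 := chebyshevSeq_recursion (2 * kanenobuPolyA) (X * kanenobuPolyA) q
  have h2 := chebyshevSeq_recursion (X * kanenobuPolyA) kanenobuPolyB q
  rw [kanenobuPoly, kanenobuPoly, kanenobuPoly]
  generalize chebyshevSeq (2 * kanenobuPolyA) (X * kanenobuPolyA) = u at *
  generalize chebyshevSeq (X * kanenobuPolyA) kanenobuPolyB = v at *
  unfold chebyshevSeq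
  linear_combination Chebyshev.S ℤ (p - 1) * h2 - Chebyshev.S ℤ (p - 2) * h1

theorem kanenobuPoly_zero_zero : kanenobuPoly 0 0 = 2 * kanenobuPolyA := by
  simp only [kanenobuPoly, chebyshevSeq_zero]

theorem kanenobuPoly_zero_one : kanenobuPoly 0 1 = X * kanenobuPolyA := by
  simp only [kanenobuPoly, chebyshevSeq_zero, chebyshevSeq_one]

theorem kanenobuPoly_one_zero : kanenobuPoly 1 0 = X * kanenobuPolyA := by
  simp only [kanenobuPoly, chebyshevSeq_zero, chebyshevSeq_one]

theorem kanenobuPoly_one_one : kanenobuPoly 1 1 = kanenobuPolyB := by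
  simp only [kanenobuPoly, chebyshevSeq_one]

theorem kanenobuPoly_zero_neg_one : kanenobuPoly 0 (-1) = X * kanenobuPolyA := by
  have h := kanenobuPoly_recursion_right 0 0
  rw [zero_add, zero_sub, kanenobuPoly_zero_zero, kanenobuPoly_zero_one] at h
  linear_combination h

theorem kanenobuPoly_one_neg_one :
    kanenobuPoly 1 (-1) = X * (X * kanenobuPolyA) - kanenobuPolyB := by
  have h := kanenobuPoly_recursion_right 1 0
  rw [zero_add, zero_sub, kanenobuPoly_one_zero, kanenobuPoly_one_one] at h
  linear_combination h

/-- The recursion is invariant under reversing the sign of an index, so only the initial values must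
be compared. They agree because `x · 2A - xA = xA` and because the value at `(-1, -1)` is `x²A -
(x²A - B) = B`. -/
theorem kanenobuPoly_neg_neg (p q : ℤ) : kanenobuPoly (-p) (-q) = kanenobuPoly p q := by
  have left (q p : ℤ) : kanenobuPoly (-(p + 1)) q + kanenobuPoly (-(p - 1)) q =
      (X : ℤ[X]) • kanenobuPoly (-p) q := by
    rw [smul_eq_mul, ← kanenobuPoly_recursion_left, add_comm]
    ring_nf
  have right (p q : ℤ) : kanenobuPoly p (-(q + 1)) + kanenobuPoly p (-(q - 1)) =
      (X : ℤ[X]) • kanenobuPoly p (-q) := by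
    rw [smul_eq_mul, ← kanenobuPoly_recursion_right, add_comm]
    ring_nf
  have h0 (q : ℤ) : kanenobuPoly 0 (-q) = kanenobuPoly 0 q :=
    eq_of_chebyshev_recursion (X : ℤ[X]) (u := fun q => kanenobuPoly 0 (-q))
      (v := kanenobuPoly 0) (right 0) (kanenobuPoly_recursion_right 0) rfl
      (by rw [kanenobuPoly_zero_neg_one, kanenobuPoly_zero_one]) q
  have h1 (q : ℤ) : kanenobuPoly (-1) (-q) = kanenobuPoly 1 q := by
    refine eq_of_chebyshev_recursion (X : ℤ[X]) (u := fun q => kanenobuPoly (-1) (-q))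
      (v := kanenobuPoly 1) (right (-1)) (kanenobuPoly_recursion_right 1) ?_ ?_ q
    · have h := kanenobuPoly_recursion_left 0 0
      rw [zero_add, zero_sub, kanenobuPoly_zero_zero, kanenobuPoly_one_zero] at h
      rw [neg_zero, kanenobuPoly_one_zero]
      linear_combination h
    · have h := kanenobuPoly_recursion_left 0 (-1)
      rw [zero_add, zero_sub, kanenobuPoly_zero_neg_one, kanenobuPoly_one_neg_one] at h
      rw [kanenobuPoly_one_one]
      linear_combination h
  exact eq_of_chebyshev_recursion (X : ℤ[X]) (u := fun p => kanenobuPoly (-p) (-q))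
    (v := fun p => kanenobuPoly p q) (left (-q)) (fun p => kanenobuPoly_recursion_left p q)
    (by rw [neg_zero, h0]) (h1 q) p

theorem natDegree_kanenobuPoly_right_pos (p : ℤ)
    (h : (kanenobuPoly p 0).natDegree ≤ (kanenobuPoly p 1).natDegree)
    (h1 : kanenobuPoly p 1 ≠ 0) (n : ℕ) :
    (kanenobuPoly p (n + 1)).natDegree = (kanenobuPoly p 1).natDegree + n := by
  have := natDegree_of_chebyshev_recursion (u := fun n => kanenobuPoly p n) (fun n => ?_)
    (by simpa using h) (by simpa using h1) n
  · simpa using this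
  · have := kanenobuPoly_recursion_right p (n + 1)
    rw [add_sub_cancel_right] at this
    push_cast
    rw [← this, add_sub_cancel_right]
    ring_nf

theorem natDegree_kanenobuPoly_right_neg (p : ℤ)
    (h : (kanenobuPoly p 0).natDegree ≤ (kanenobuPoly p (-1)).natDegree)
    (h1 : kanenobuPoly p (-1) ≠ 0) (n : ℕ) :
    (kanenobuPoly p (-(n + 1))).natDegree = (kanenobuPoly p (-1)).natDegree + n := by
  have := natDegree_of_chebyshev_recursion (u := fun n => kanenobuPoly p (-n)) (fun n => ?_)
    (by simpa using h) (by simpa using h1) n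
  · simpa using this
  · have := kanenobuPoly_recursion_right p (-(n + 1))
    push_cast
    rw [← this]
    ring_nf

theorem natDegree_kanenobuPoly_left_pos (q : ℤ)
    (h : (kanenobuPoly 0 q).natDegree ≤ (kanenobuPoly 1 q).natDegree)
    (h1 : kanenobuPoly 1 q ≠ 0) (n : ℕ) :
    (kanenobuPoly (n + 1) q).natDegree = (kanenobuPoly 1 q).natDegree + n := by
  have := natDegree_of_chebyshev_recursion (u := fun n => kanenobuPoly n q) (fun n => ?_)
    (by simpa using h) (by simpa using h1) n
  · simpa using this
  · have := kanenobuPoly_recursion_left (n + 1) q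
    rw [add_sub_cancel_right] at this
    push_cast
    rw [← this, add_sub_cancel_right]
    ring_nf

theorem ne_zero_of_natDegree {f : ℤ[X]} {n : ℕ} (h : f.natDegree = n + 1) : f ≠ 0 := by
  rintro rfl
  simp at h

theorem natDegree_kanenobuPoly_zero (q : ℤ) : (kanenobuPoly 0 q).natDegree = q.natAbs + 6 := by
  wlog hq : 0 ≤ q generalizing q
  · have := this (-q) (by omega)
    -- Reading the first index as `-0` makes the symmetry of both signs applicable.
    rwa [← neg_zero, kanenobuPoly_neg_neg, Int.natAbs_neg] at this
  lift q to ℕ using hq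
  have h0 : (kanenobuPoly 0 0).natDegree = 6 := by
    rw [kanenobuPoly_zero_zero, natDegree_two_mul_kanenobuPolyA]
  have h1 : (kanenobuPoly 0 1).natDegree = 7 := by
    rw [kanenobuPoly_zero_one, natDegree_X_mul_kanenobuPolyA]
  obtain _ | n := q
  · simpa using h0
  · have := natDegree_kanenobuPoly_right_pos 0 (by omega) (ne_zero_of_natDegree h1) n
    push_cast
    omega

theorem natDegree_kanenobuPoly_one (q : ℤ) : (kanenobuPoly 1 q).natDegree =
    if 0 ≤ q then q.natAbs + 7 else q.natAbs + 6 := by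
  have h0 : (kanenobuPoly 1 0).natDegree = 7 := by
    rw [kanenobuPoly_one_zero, natDegree_X_mul_kanenobuPolyA]
  split_ifs with hq
  · lift q to ℕ using hq
    have h1 : (kanenobuPoly 1 1).natDegree = 8 := by
      rw [kanenobuPoly_one_one, natDegree_kanenobuPolyB]
    obtain _ | n := q
    · simpa using h0
    · have := natDegree_kanenobuPoly_right_pos 1 (by omega) (ne_zero_of_natDegree h1) n
      push_cast
      omega
  · obtain ⟨n, rfl⟩ : ∃ n : ℕ, q = -(n + 1) := ⟨q.natAbs - 1, by omega⟩
    have h1 : (kanenobuPoly 1 (-1)).natDegree = 7 := by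
      rw [kanenobuPoly_one_neg_one, natDegree_sub_kanenobuPolyB]
    have := natDegree_kanenobuPoly_right_neg 1 (by omega) (ne_zero_of_natDegree h1) n
    omega

theorem natDegree_kanenobuPoly (p q : ℤ) : (kanenobuPoly p q).natDegree =
    if 0 ≤ p * q then p.natAbs + q.natAbs + 6 else p.natAbs + q.natAbs + 5 := by
  wlog hp : 0 ≤ p generalizing p q
  · have := this (-p) (-q) (by omega)
    rwa [kanenobuPoly_neg_neg, neg_mul_neg, Int.natAbs_neg, Int.natAbs_neg] at this
  lift p to ℕ using hp
  obtain _ | n := p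
  · simpa using natDegree_kanenobuPoly_zero q
  have h0 := natDegree_kanenobuPoly_zero q
  have h1 := natDegree_kanenobuPoly_one q
  have hpos : (0 : ℤ) < (n + 1 : ℕ) := by positivity
  have hiff : (0 ≤ ((n + 1 : ℕ) : ℤ) * q) ↔ 0 ≤ q := mul_nonneg_iff_of_pos_left hpos
  have hne : kanenobuPoly 1 q ≠ 0 := by
    intro h
    rw [h, natDegree_zero] at h1
    split_ifs at h1
  -- For `q < 0` the degrees at `p = 0` and `p = 1` coincide, which the weak inequality permits.
  have := natDegree_kanenobuPoly_left_pos q (by split_ifs at h1 <;> omega) hne n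
  simp only [hiff]
  push_cast
  rw [this, h1]
  split_ifs <;> omega

end Degree

namespace Ket

/-- Subtracting the circle absorbs the constant term `xδ = 2 - x` and makes the recursions
homogeneous; both sides then agree once the four initial values do. -/
theorem kanenobu_sub_circle (p q : ℤ) :
    kanenobu p q - circle = (kanenobuPoly p q).toLaurent • circle := by
  have left (q p : ℤ) : (kanenobu (p + 1) q - circle) + (kanenobu (p - 1) q - circle) =
      (T 1 : ℤ[T;T⁻¹]) • (kanenobu p q - circle) := by
    have h := kanenobu_recursion_left p q
    rw [smul_add, smul_smul, T_mul_unlinkTwo] at h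
    rw [sub_add_sub_comm, h]
    module
  have right (p q : ℤ) : (kanenobu p (q + 1) - circle) + (kanenobu p (q - 1) - circle) =
      (T 1 : ℤ[T;T⁻¹]) • (kanenobu p q - circle) := by
    have h := kanenobu_recursion_right p q
    rw [smul_add, smul_smul, T_mul_unlinkTwo] at h
    rw [sub_add_sub_comm, h]
    module
  have left' (q p : ℤ) : (kanenobuPoly (p + 1) q).toLaurent • circle +
      (kanenobuPoly (p - 1) q).toLaurent • circle =
      (T 1 : ℤ[T;T⁻¹]) • (kanenobuPoly p q).toLaurent • circle := by
    rw [← add_smul, ← map_add, kanenobuPoly_recursion_left, map_mul, Polynomial.toLaurent_X,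
      mul_smul]
  have right' (p q : ℤ) : (kanenobuPoly p (q + 1)).toLaurent • circle +
      (kanenobuPoly p (q - 1)).toLaurent • circle =
      (T 1 : ℤ[T;T⁻¹]) • (kanenobuPoly p q).toLaurent • circle := by
    rw [← add_smul, ← map_add, kanenobuPoly_recursion_right, map_mul, Polynomial.toLaurent_X,
      mul_smul]
  refine eq_of_chebyshev_recursion (T 1)
    (u := fun p => kanenobu p q - circle) (v := fun p => (kanenobuPoly p q).toLaurent • circle)
        (left q) (left' q) ?_ ?_ p
  · refine eq_of_chebyshev_recursion (T 1)
      (u := fun q => kanenobu 0 q - circle) (v := fun q => (kanenobuPoly 0 q).toLaurent • circle)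
          (right 0) (right' 0) ?_ ?_ q
    · rw [kanenobu_zero_zero, kanenobuPoly_zero_zero, kanenobuPolyA]
      simp only [map_add, map_sub, map_mul, map_pow, map_ofNat, Polynomial.toLaurent_X]
      module
    · rw [kanenobu_zero_one, kanenobuPoly_zero_one, kanenobuPolyA]
      simp only [map_add, map_sub, map_mul, map_pow, map_ofNat, Polynomial.toLaurent_X]
      module
  · refine eq_of_chebyshev_recursion (T 1)
      (u := fun q => kanenobu 1 q - circle) (v := fun q => (kanenobuPoly 1 q).toLaurent • circle)
          (right 1) (right' 1) ?_ ?_ q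
    · rw [kanenobu_one_zero, kanenobuPoly_one_zero, kanenobuPolyA]
      simp only [map_add, map_sub, map_mul, map_pow, map_ofNat, Polynomial.toLaurent_X]
      module
    · rw [kanenobu_one_one, kanenobuPoly_one_one, kanenobuPolyB]
      simp only [map_add, map_sub, map_mul, map_pow, map_ofNat, Polynomial.toLaurent_X]
      module

end Ket

theorem hasQPolynomial_kanenobuKnot (p q : ℤ) :
    HasQPolynomial (kanenobuKnot p q) (kanenobuPoly p q + 1).toLaurent := by
  rw [hasQPolynomial_iff, ← Ket.kanenobu_apply_nil, ← Ket.circle_apply_nil, map_add, map_one,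
    add_smul, one_smul]
  -- Evaluation at the empty continuation passes from functionals to classes in the skein module.
  have h := congrArg (fun k => k.1 []) (sub_eq_iff_eq_add.1 (Ket.kanenobu_sub_circle p q))
  exact h

end SkeinCalculus

/-! ## Solutions of the Yang-Baxter equation of orthogonal type -/

/-- Tensors for the elementary tangles with colours in `C`: a positive crossing `R`, a local
minimum `U` and a local maximum `A`, that satisfy the relations of the Dubrovnik version of the
Kauffman polynomial with parameters `z` and `α`. -/
structure DubrovnikModel (K C : Type*) [Field K] (z α : K) where
  R : (C → C → K) →ₗ[K] (C → C → K)
  U : (C → C → K) →ₗ[K] K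
  A : C → C → K
  zigzag (f : C → K) (a : C) : U (fun x y => A a x * f y) = f a
  zagzig (f : C → K) (a : C) : U (fun x y => A y a * f x) = f a
  U_A : z * α * U A = 1 + z * α - α ^ 2
  R_A (a b : C) : R A a b = α * A a b
  U_R (f : C → C → K) : U (R f) = α * U f
  R_R (f : C → C → K) (a b : C) : R (R f) a b = f a b + z * R f a b - z * α * (A a b * U f)
  -- Sliding past an extremum changes a crossing into its inverse. Here the inverse is written as `R
  -- - z + z A U`, which produces the two correction terms.
  slide_cap (f : C → K) (a b c : C) : R (fun x y => A y c * f x) a b =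
    R (fun x y => A a x * f y) b c - z * (A a b * f c) + z * (A b c * f a)
  slide_cup (f : C → C → C → K) (a : C) : U (fun c d => R (fun x y => f x y d) a c) =
    U (fun c d => R (fun x y => f c x y) d a) - z * U (fun c d => f c d a) +
      z * U (fun c d => f a c d)
  braid (f : C → C → C → K) (a b c : C) :
    R (fun x y => R (fun y' w => R (fun x' y'' => f x' y'' w) x y') y c) a b =
      R (fun y w => R (fun x' y' => R (fun y'' w' => f x' y'' w') y' w) a y) b c

set_option linter.unusedSimpArgs false

namespace DubrovnikModel

variable {K C : Type*} [Field K] {z α : K} (M : DubrovnikModel K C z α)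

theorem R_add (f g : C → C → K) (a b : C) :
    M.R (fun x y => f x y + g x y) a b = M.R f a b + M.R g a b :=
  congrFun (congrFun (M.R.map_add f g) a) b

theorem R_sub (f g : C → C → K) (a b : C) :
    M.R (fun x y => f x y - g x y) a b = M.R f a b - M.R g a b :=
  congrFun (congrFun (M.R.map_sub f g) a) b

theorem R_mul (k : K) (f : C → C → K) (a b : C) :
    M.R (fun x y => k * f x y) a b = k * M.R f a b :=
  congrFun (congrFun (M.R.map_smul k f) a) b

theorem R_mul_right (k : K) (f : C → C → K) (a b : C) :
    M.R (fun x y => f x y * k) a b = k * M.R f a b := by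
  simp only [mul_comm _ k, R_mul]

theorem R_zero (a b : C) : M.R (fun _ _ => 0) a b = 0 :=
  congrFun (congrFun M.R.map_zero a) b

theorem U_add (f g : C → C → K) : M.U (fun x y => f x y + g x y) = M.U f + M.U g :=
  M.U.map_add f g

theorem U_sub (f g : C → C → K) : M.U (fun x y => f x y - g x y) = M.U f - M.U g :=
  M.U.map_sub f g

theorem U_mul (k : K) (f : C → C → K) : M.U (fun x y => k * f x y) = k * M.U f :=
  M.U.map_smul k f

theorem U_mul_right (k : K) (f : C → C → K) : M.U (fun x y => f x y * k) = k * M.U f := by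
  simp only [mul_comm _ k, U_mul]

theorem U_zero : M.U (fun _ _ => 0) = 0 := M.U.map_zero

/-! ### Strands passing local extrema. -/

theorem R_eq_of_slide (g : C → K) (a b c : C) : M.R (fun x y => M.A a x * g y) b c =
    M.R (fun x y => M.A y c * g x) a b + z * (M.A a b * g c) - z * (M.A b c * g a) := by
  rw [M.slide_cap]
  ring

/-- A strand crossing both legs of a maximum can be pulled off: sliding produces `R` twice on the
same strands, and the quadratic relation and a zigzag finish. -/
theorem R_R_A_left (g : C → K) (a b c : C) :
    M.R (fun x y => M.R (fun x' w => M.A x x' * g w) y c) a b = M.A b c * g a := by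
  simp only [R_eq_of_slide, R_add, R_sub, R_mul, R_mul_right, R_A]
  change M.R (M.R fun u v => M.A v c * g u) a b + _ - _ = _
  rw [R_R, zagzig]
  ring

theorem R_R_A_right (g : C → K) (a b c : C) :
    M.R (fun x y => M.R (fun u v => M.A v y * g u) a x) b c = M.A a b * g c := by
  simp only [slide_cap, R_add, R_sub, R_mul, R_mul_right, R_A]
  change M.R (M.R fun u v => M.A a u * g v) b c - _ + _ = _
  rw [R_R, zigzag]
  ring

theorem U_R_R_left (f : C → C → C → K) (c : C) :
    M.U (fun x y => M.R (fun x' w => M.R (fun u v => f u v w) x x') y c) =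
      M.U (fun x y => f c x y) := by
  have h := M.slide_cup (fun x y d => M.R (fun u v => f u v d) x y) c
  have h1 (d a b : C) : M.R (fun x y => M.R (fun u v => f u v d) x y) a b =
      f a b d + z * M.R (fun u v => f u v d) a b - z * α * (M.A a b * M.U fun u v => f u v d) :=
    M.R_R (fun u v => f u v d) a b
  have h2 : (M.U fun x y => M.R (fun u v => f u v c) x y) = α * M.U fun u v => f u v c :=
    M.U_R fun u v => f u v c
  simp only [h1, U_add, U_sub, U_mul, zigzag, h2] at h
  linear_combination -h

theorem U_R_R_right (f : C → C → C → K) (a : C) :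
    M.U (fun x y => M.R (fun x' w => M.R (fun u v => f x' u v) w y) a x) =
      M.U (fun x y => f x y a) := by
  have h := M.slide_cup (fun x y d => M.R (fun u v => f x u v) y d) a
  have h1 (d b c : C) : M.R (fun x y => M.R (fun u v => f d u v) x y) b c =
      f d b c + z * M.R (fun u v => f d u v) b c - z * α * (M.A b c * M.U fun u v => f d u v) :=
    M.R_R (fun u v => f d u v) b c
  have h2 : (M.U fun x y => M.R (fun u v => f a u v) x y) = α * M.U fun u v => f a u v :=
    M.U_R fun u v => f a u v
  simp only [h1, U_add, U_sub, U_mul, zagzig, h2] at h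
  linear_combination h

/-- This is a kink of the opposite sign, hence the inverse factor. -/
theorem U_R_A_left (hα : α ≠ 0) (g : C → K) (c : C) :
    M.U (fun x y => M.R (fun x' w => M.A x x' * g w) y c) = α⁻¹ * g c := by
  have h : (M.U fun x y => M.R (fun u v => M.A v c * g u) x y) = α * g c := by
    rw [← M.zagzig g c]
    exact M.U_R _
  have h' := M.U_A
  simp only [R_eq_of_slide, U_add, U_sub, U_mul, U_mul_right, zagzig, h]
  field_simp
  linear_combination g c * h'

theorem U_R_A_right (hα : α ≠ 0) (g : C → K) (a : C) :
    M.U (fun x y => M.R (fun u v => M.A v y * g u) a x) = α⁻¹ * g a := by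
  have h : (M.U fun x y => M.R (fun u v => M.A a u * g v) x y) = α * g a := by
    rw [← M.zigzag g a]
    exact M.U_R _
  have h' := M.U_A
  simp only [slide_cap, U_add, U_sub, U_mul, U_mul_right, zigzag, h]
  field_simp
  linear_combination g a * h'

/-- The crossing of the extension of a model by two colours, `none` and `some none`. -/
def extR (q : K) (f : Option (Option C) → Option (Option C) → K) :
    Option (Option C) → Option (Option C) → K
  -- The colour `none` precedes and `some none` follows all old colours. Between an old and a new
  -- colour, the extra `z` term occurs exactly for pairs in increasing order; pairs of dual new
  -- colours also mix with the old ones through `A` and `U`.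
  | none, none => q * f none none
  | none, some none => q⁻¹ * f (some none) none + z * (1 - α / q) * f none (some none) -
      z * M.U (fun c d => f (some (some c)) (some (some d)))
  | none, some (some c) => f (some (some c)) none + z * f none (some (some c))
  | some none, none => q⁻¹ * f none (some none)
  | some none, some none => q * f (some none) (some none)
  | some none, some (some c) => f (some (some c)) (some none)
  | some (some c), none => f none (some (some c))
  | some (some c), some none => f (some none) (some (some c)) + z * f (some (some c)) (some none)
  | some (some c), some (some d) => M.R (fun x y => f (some (some x)) (some (some y))) c d -
      z * (α / q) * (M.A c d * f none (some none))

/-- The local minimum of the extension of a model by two colours. -/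
def extU (q : K) (f : Option (Option C) → Option (Option C) → K) : K :=
  α / q * f none (some none) + f (some none) none +
    M.U (fun c d => f (some (some c)) (some (some d)))

/-- The local maximum of the extension of a model by two colours. -/
def extA (q : K) : Option (Option C) → Option (Option C) → K
  | none, some none => 1
  | some none, none => q / α
  | some (some c), some (some d) => M.A c d
  | _, _ => 0

section Extension

variable (q : K)

theorem extR_add (f g : Option (Option C) → Option (Option C) → K) :
    M.extR q (f + g) = M.extR q f + M.extR q g := by
  funext a b
  rcases a with _ | _ | a <;> rcases b with _ | _ | b <;>
    simp only [extR, Pi.add_apply, R_add, U_add] <;> try ring1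

theorem extR_smul (k : K) (f : Option (Option C) → Option (Option C) → K) :
    M.extR q (k • f) = k • M.extR q f := by
  funext a b
  rcases a with _ | _ | a <;> rcases b with _ | _ | b <;>
    simp only [extR, Pi.smul_apply, smul_eq_mul, R_mul, U_mul] <;> try ring1

theorem extU_add (f g : Option (Option C) → Option (Option C) → K) :
    M.extU q (f + g) = M.extU q f + M.extU q g := by
  simp only [extU, Pi.add_apply, U_add]
  ring

theorem extU_smul (k : K) (f : Option (Option C) → Option (Option C) → K) :
    M.extU q (k • f) = k • M.extU q f := by
  simp only [extU, Pi.smul_apply, smul_eq_mul, U_mul]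
  ring

variable {q}

theorem ext_zigzag (hq : q ≠ 0) (hα : α ≠ 0) (f : Option (Option C) → K) (a : Option (Option C)) :
    M.extU q (fun x y => M.extA q a x * f y) = f a := by
  rcases a with _ | _ | a <;> simp [extU, extA, U_zero, zigzag]
  field_simp

theorem ext_zagzig (hq : q ≠ 0) (hα : α ≠ 0) (f : Option (Option C) → K) (a : Option (Option C)) :
    M.extU q (fun x y => M.extA q y a * f x) = f a := by
  rcases a with _ | _ | a <;> simp [extU, extA, U_zero, zagzig]
  field_simp

theorem ext_R_R (hq : q ≠ 0) (hα : α ≠ 0) (hz : z = q - q⁻¹)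
    (f : Option (Option C) → Option (Option C) → K) (a b : Option (Option C)) :
    M.extR q (M.extR q f) a b = f a b + z * M.extR q f a b -
      z * (α / q ^ 2) * (M.extA q a b * M.extU q f) := by
  have h1 (g : C → C → K) (a b : C) : M.R (fun x y => M.R g x y) a b =
      g a b + z * M.R g a b - z * α * (M.A a b * M.U g) := M.R_R g a b
  have h2 (g : C → C → K) : (M.U fun x y => M.R g x y) = α * M.U g := M.U_R g
  -- Closed loops in the old colours are eliminated through `U_A`.
  have h3 (x : K) : z * (α / q) * (x * M.U M.A) = (1 + z * α - α ^ 2) / q * x := by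
    rw [← M.U_A]
    ring
  rcases a with _ | _ | a <;> rcases b with _ | _ | b <;>
    simp only [extR, extA, extU, R_add, R_sub, R_mul, U_add, U_sub, U_mul, R_mul_right, U_mul_right,
      h1, h2, h3, R_A]
  all_goals (first | ring1 | (subst hz; field_simp; done) | (subst hz; field_simp; ring1))

theorem ext_U_A (hq : q ≠ 0) (hα : α ≠ 0) (hz : z = q - q⁻¹) :
    z * (α / q ^ 2) * M.extU q (M.extA q) = 1 + z * (α / q ^ 2) - (α / q ^ 2) ^ 2 := by
  have h : z * (α / q ^ 2) * (M.U fun c d => M.A c d) = (1 + z * α - α ^ 2) / q ^ 2 := by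
    rw [← M.U_A]
    ring
  simp only [extU, extA, mul_add, h]
  subst hz
  field_simp
  ring1

theorem ext_R_A (hq : q ≠ 0) (hα : α ≠ 0) (hz : z = q - q⁻¹) (a b : Option (Option C)) :
    M.extR q (M.extA q) a b = α / q ^ 2 * M.extA q a b := by
  have h1 (a b : C) : M.R (fun x y => M.A x y) a b = α * M.A a b := M.R_A a b
  have h : z * (M.U fun c d => M.A c d) = (1 + z * α - α ^ 2) / α := by
    rw [← M.U_A]
    field_simp
  rcases a with _ | _ | a <;> rcases b with _ | _ | b <;>
    simp only [extR, extA, h1, h]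
  all_goals (first | ring1 | (subst hz; field_simp; done) | (subst hz; field_simp; ring1))

theorem ext_U_R (hq : q ≠ 0) (hz : z = q - q⁻¹) (f : Option (Option C) → Option (Option C) → K) :
    M.extU q (M.extR q f) = α / q ^ 2 * M.extU q f := by
  have h (x : K) : z * (α / q) * (x * M.U fun c d => M.A c d) =
      (1 + z * α - α ^ 2) / q * x := by
    rw [← M.U_A]
    ring
  have h2 (g : C → C → K) : (M.U fun x y => M.R g x y) = α * M.U g := M.U_R g
  simp only [extR, extU, U_sub, U_mul, U_mul_right, h2, h]
  subst hz
  field_simp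
  ring1

theorem ext_slide_cap (hq : q ≠ 0) (hα : α ≠ 0) (hz : z = q - q⁻¹)
    (f : Option (Option C) → K) (a b c : Option (Option C)) :
    M.extR q (fun x y => M.extA q y c * f x) a b =
      M.extR q (fun x y => M.extA q a x * f y) b c - z * (M.extA q a b * f c) +
        z * (M.extA q b c * f a) := by
  rcases a with _ | _ | a <;> rcases b with _ | _ | b <;> rcases c with _ | _ | c <;>
    simp only [extR, extA, R_mul, R_zero, U_zero, R_mul_right, slide_cap, U_mul, U_mul_right,
      zigzag, zagzig, mul_zero, zero_mul]
  all_goals (first | ring1 | (subst hz; field_simp; done) | (subst hz; field_simp; ring1))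

theorem ext_slide_cup (hq : q ≠ 0) (hz : z = q - q⁻¹)
    (f : Option (Option C) → Option (Option C) → Option (Option C) → K) (a : Option (Option C)) :
    M.extU q (fun c d => M.extR q (fun x y => f x y d) a c) =
      M.extU q (fun c d => M.extR q (fun x y => f c x y) d a) - z * M.extU q (fun c d => f c d a) +
        z * M.extU q (fun c d => f a c d) := by
  rcases a with _ | _ | a <;>
    simp only [extR, extU, U_add, U_sub, U_mul, U_mul_right, slide_cup, zigzag, zagzig]
  all_goals (first | ring1 | (subst hz; field_simp; done) | (subst hz; field_simp; ring1))

/-- Three old colours involve the old braid relation. In the other cases strands of old colours are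
simplified by the passing relations, and identities in `q` and `α` remain. -/
theorem ext_braid (hq : q ≠ 0) (hα : α ≠ 0) (hz : z = q - q⁻¹)
    (f : Option (Option C) → Option (Option C) → Option (Option C) → K)
    (a b c : Option (Option C)) :
    M.extR q (fun x y => M.extR q (fun y' w => M.extR q (fun x' y'' => f x' y'' w) x y') y c) a b =
      M.extR q (fun y w => M.extR q (fun x' y' => M.extR q (fun y'' w' => f x' y'' w') y' w) a y)
        b c := by
  have h1 (g : C → C → K) (a b : C) : M.R (fun x y => M.R g x y) a b =
      g a b + z * M.R g a b - z * α * (M.A a b * M.U g) := M.R_R g a b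
  have h2 (g : C → C → K) : (M.U fun x y => M.R g x y) = α * M.U g := M.U_R g
  have h3 (x : K) : z * (α / q) * (x * M.U M.A) = (1 + z * α - α ^ 2) / q * x := by
    rw [← M.U_A]
    ring
  rcases a with _ | _ | a <;> rcases b with _ | _ | b <;> rcases c with _ | _ | c <;>
    simp only [extR, R_add, R_sub, R_mul, U_add, U_sub, U_mul, R_mul_right, U_mul_right,
      U_R_R_left, U_R_R_right, R_R_A_left, R_R_A_right, U_R_A_left _ hα, U_R_A_right _ hα,
      zigzag, zagzig, slide_cup, braid, h1, h2, h3, R_A]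
  all_goals (first | (simp only [slide_cap]; ring1) | ring1 | (subst hz; field_simp; done) |
    (subst hz; field_simp; ring1))

/-- The extension of a model by two colours. -/
def ext (hq : q ≠ 0) (hα : α ≠ 0) (hz : z = q - q⁻¹) :
    DubrovnikModel K (Option (Option C)) z (α / q ^ 2) where
  R := { toFun := M.extR q, map_add' := M.extR_add q, map_smul' := M.extR_smul q }
  U := { toFun := M.extU q, map_add' := M.extU_add q, map_smul' := M.extU_smul q }
  A := M.extA q
  zigzag := M.ext_zigzag hq hα
  zagzig := M.ext_zagzig hq hα
  U_A := M.ext_U_A hq hα hz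
  R_A := M.ext_R_A hq hα hz
  U_R := M.ext_U_R hq hz
  R_R := M.ext_R_R hq hα hz
  slide_cap := M.ext_slide_cap hq hα hz
  slide_cup := M.ext_slide_cup hq hz
  braid := M.ext_braid hq hα hz

end Extension

/-- The model with one colour. -/
def unit (K : Type*) [Field K] (z : K) : DubrovnikModel K Unit z 1 where
  R := LinearMap.id
  U := { toFun := fun f => f () (), map_add' := fun _ _ => rfl, map_smul' := fun _ _ => rfl }
  A := fun _ _ => 1
  zigzag _ _ := by simp
  zagzig _ _ := by simp
  U_A := by simp
  R_A _ _ := by simp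
  U_R _ := by simp
  R_R _ _ _ := by simp
  slide_cap _ _ _ _ := by simp
  slide_cup _ _ := by simp
  braid _ _ _ _ := rfl

/-- Models with parameters of the orthogonal series exist. -/
theorem exists_model {q : K} (hq : q ≠ 0) (n : ℕ) :
    ∃ (C : Type) (_ : Fintype C) (_ : Nonempty C),
      Nonempty (DubrovnikModel K C (q - q⁻¹) ((q ^ (2 * n))⁻¹)) := by
  induction n with
  | zero => exact ⟨Unit, inferInstance, inferInstance, ⟨by simpa using unit K (q - q⁻¹)⟩⟩
  | succ n ih =>
    obtain ⟨C, hC, -, ⟨M⟩⟩ := ih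
    refine ⟨Option (Option C), inferInstance, inferInstance, ⟨?_⟩⟩
    have e : (q ^ (2 * (n + 1)))⁻¹ = (q ^ (2 * n))⁻¹ / q ^ 2 := by
      rw [mul_add, pow_add, mul_inv, div_eq_mul_inv, mul_one]
    rw [e]
    exact M.ext hq (inv_ne_zero (pow_ne_zero _ hq)) rfl

end DubrovnikModel

/-! ## State sums -/

section StateSum

variable {K C : Type*} [Field K]

/-- Functions on the colourings of infinitely many strands. -/
abbrev ColorFun (K C : Type*) : Type _ := Stream' C → K

open Stream'

/-- The operator on the strands behind the first one. -/
def shift : Module.End K (ColorFun K C) →* Module.End K (ColorFun K C) where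
  -- With infinitely many strands a layer at position `i` is the `i`-fold shift of the layer at
  -- position 0, so widths need not be tracked and relations at the left end hold everywhere.
  toFun T :=
    { toFun := fun f s => T (fun t => f (cons s.head t)) s.tail
      map_add' := fun f g => funext fun s =>
        congrFun (T.map_add (fun t => f (cons s.head t)) fun t => g (cons s.head t)) s.tail
      map_smul' := fun k f => funext fun s =>
        congrFun (T.map_smul k fun t => f (cons s.head t)) s.tail }
  map_one' := LinearMap.ext fun f => funext fun s => congrArg f s.eta
  map_mul' _ _ := rfl

theorem shift_add (S T : Module.End K (ColorFun K C)) : shift (S + T) = shift S + shift T := rfl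

theorem shift_sub (S T : Module.End K (ColorFun K C)) : shift (S - T) = shift S - shift T := rfl

theorem shift_smul (k : K) (T : Module.End K (ColorFun K C)) : shift (k • T) = k • shift T := rfl

theorem shift_iterate_mul (i : ℕ) (S T : Module.End K (ColorFun K C)) :
    shift^[i] (S * T) = shift^[i] S * shift^[i] T := by
  induction i generalizing S T with
  | zero => rfl
  | succ i ih => simp only [Function.iterate_succ_apply, map_mul, ih]

theorem shift_iterate_one (i : ℕ) : shift^[i] (1 : Module.End K (ColorFun K C)) = 1 := by
  induction i with
  | zero => rfl
  | succ i ih => rw [Function.iterate_succ_apply, map_one, ih]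

theorem shift_iterate_smul (i : ℕ) (k : K) (T : Module.End K (ColorFun K C)) :
    shift^[i] (k • T) = k • shift^[i] T := by
  induction i generalizing T with
  | zero => rfl
  | succ i ih => simp only [Function.iterate_succ_apply, shift_smul, ih]

theorem shift_iterate_add (i : ℕ) (S T : Module.End K (ColorFun K C)) :
    shift^[i] (S + T) = shift^[i] S + shift^[i] T := by
  induction i generalizing S T with
  | zero => rfl
  | succ i ih => simp only [Function.iterate_succ_apply, shift_add, ih]

theorem shift_iterate_sub (i : ℕ) (S T : Module.End K (ColorFun K C)) :
    shift^[i] (S - T) = shift^[i] S - shift^[i] T := by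
  induction i generalizing S T with
  | zero => rfl
  | succ i ih => simp only [Function.iterate_succ_apply, shift_sub, ih]

namespace DubrovnikModel

variable {z α : K} (M : DubrovnikModel K C z α)

/-- The operator of a positive crossing. -/
def opR : Module.End K (ColorFun K C) where
  toFun f s := M.R (fun x y => f (cons x (cons y s.tail.tail))) s.head s.tail.head
  map_add' _ _ := funext fun _ => M.R_add _ _ _ _
  map_smul' _ _ := funext fun _ => M.R_mul _ _ _ _

/-- The operator of a local minimum. -/
def opU : Module.End K (ColorFun K C) where
  toFun f s := M.U fun x y => f (cons x (cons y s))
  map_add' _ _ := funext fun _ => M.U_add _ _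
  map_smul' _ _ := funext fun _ => M.U_mul _ _

/-- The operator of a local maximum. -/
def opA : Module.End K (ColorFun K C) where
  toFun f s := M.A s.head s.tail.head * f s.tail.tail
  map_add' _ _ := funext fun _ => mul_add _ _ _
  map_smul' _ _ := funext fun _ => mul_left_comm _ _ _

/-- The inverse crossing. -/
def opR' : Module.End K (ColorFun K C) := M.opR - z • 1 + z • (M.opA * M.opU)

/-! ### Relations between the operators of elementary tangles. -/

theorem shift_opU_mul_opA : shift M.opU * M.opA = 1 := by
  refine LinearMap.ext fun f => funext fun s => ?_
  change M.U (fun x y => M.A s.head x * f (cons y s.tail)) = f s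
  rw [M.zigzag (fun y => f (cons y s.tail)), s.eta]

theorem opU_mul_shift_opA : M.opU * shift M.opA = 1 := by
  refine LinearMap.ext fun f => funext fun s => ?_
  change M.U (fun x y => M.A y s.head * f (cons x s.tail)) = f s
  rw [M.zagzig (fun y => f (cons y s.tail)), s.eta]

theorem opR_mul_opA : M.opR * M.opA = α • M.opA := by
  refine LinearMap.ext fun f => funext fun s => ?_
  change M.R (fun x y => M.A x y * f s.tail.tail) s.head s.tail.head =
    α * (M.A s.head s.tail.head * f s.tail.tail)
  rw [R_mul_right, R_A]
  ring

theorem opU_mul_opR : M.opU * M.opR = α • M.opU :=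
  LinearMap.ext fun f => funext fun s => M.U_R fun x y => f (cons x (cons y s))

theorem opR_mul_opR : M.opR * M.opR = 1 + z • M.opR - (z * α) • (M.opA * M.opU) := by
  refine LinearMap.ext fun f => funext fun s => ?_
  refine (M.R_R (fun x y => f (cons x (cons y s.tail.tail))) s.head s.tail.head).trans ?_
  rw [s.tail.eta, s.eta]
  rfl

theorem opR_mul_shift_opA :
    M.opR * shift M.opA = shift M.opR * M.opA - z • M.opA + z • shift M.opA := by
  refine LinearMap.ext fun f => funext fun s => ?_
  refine (M.slide_cap (fun x => f (cons x s.tail.tail.tail)) s.head s.tail.head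
    s.tail.tail.head).trans ?_
  rw [s.tail.tail.eta]
  rfl

theorem shift_opU_mul_opR :
    shift M.opU * M.opR = M.opU * shift M.opR - z • M.opU + z • shift M.opU := by
  refine LinearMap.ext fun f => funext fun s => ?_
  refine (M.slide_cup (fun x y w => f (cons x (cons y (cons w s.tail)))) s.head).trans ?_
  conv_rhs => rw [← s.eta]
  rfl

theorem opR_braid :
    M.opR * shift M.opR * M.opR = shift M.opR * M.opR * shift M.opR := by
  refine LinearMap.ext fun f => funext fun s => ?_
  exact M.braid (fun x y w => f (cons x (cons y (cons w s.tail.tail.tail)))) s.head s.tail.head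
    s.tail.tail.head

theorem opR'_mul_opR : M.opR' * M.opR = 1 := by
  rw [opR', add_mul, sub_mul, smul_mul_assoc, smul_mul_assoc, mul_assoc, opU_mul_opR, opR_mul_opR,
    one_mul, mul_smul_comm]
  module

theorem opR_mul_opR' : M.opR * M.opR' = 1 := by
  rw [opR', mul_add, mul_sub, mul_smul_comm, mul_smul_comm, ← mul_assoc, opR_mul_opA, opR_mul_opR,
    mul_one, smul_mul_assoc]
  module

theorem opR'_mul_opA (hα : α ≠ 0) : M.opR' * M.opA = α⁻¹ • M.opA := by
  have h := congrArg (M.opR' * ·) M.opR_mul_opA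
  simp only [← mul_assoc, opR'_mul_opR, one_mul, mul_smul_comm] at h
  conv_rhs => rw [h, smul_smul, inv_mul_cancel₀ hα, one_smul]

theorem opU_mul_opR' (hα : α ≠ 0) : M.opU * M.opR' = α⁻¹ • M.opU := by
  have h := congrArg (· * M.opR') M.opU_mul_opR
  simp only [mul_assoc, opR_mul_opR', mul_one, smul_mul_assoc] at h
  conv_rhs => rw [h, smul_smul, inv_mul_cancel₀ hα, one_smul]

theorem shift_opR' : shift M.opR' = shift M.opR - z • 1 + z • (shift M.opA * shift M.opU) := by
  rw [opR', shift_add, shift_sub, shift_smul, shift_smul, map_mul, map_one]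

theorem opR_slide : M.opR * shift M.opA = shift M.opR' * M.opA := by
  rw [shift_opR', add_mul, sub_mul, smul_mul_assoc, smul_mul_assoc, mul_assoc, shift_opU_mul_opA,
    opR_mul_shift_opA, one_mul, mul_one]

theorem opR'_slide : M.opR' * shift M.opA = shift M.opR * M.opA := by
  rw [opR', add_mul, sub_mul, smul_mul_assoc, smul_mul_assoc, mul_assoc, opU_mul_shift_opA,
    opR_mul_shift_opA, one_mul, mul_one]
  module

theorem slide_opR : shift M.opU * M.opR = M.opU * shift M.opR' := by
  rw [shift_opR', mul_add, mul_sub, mul_smul_comm, mul_smul_comm, ← mul_assoc, opU_mul_shift_opA,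
    shift_opU_mul_opR, one_mul, mul_one]

theorem slide_opR' : shift M.opU * M.opR' = M.opU * shift M.opR := by
  rw [opR', mul_add, mul_sub, mul_smul_comm, mul_smul_comm, ← mul_assoc, shift_opU_mul_opA,
    shift_opU_mul_opR, one_mul, mul_one]
  module

end DubrovnikModel

/-- As there are finitely many colours, `L` is a finite combination of evaluations, and `T` commutes
with finite sums. This yields the commutation of distant layers. -/
theorem apply_sum_comm [Fintype C] (L : (C → C → K) →ₗ[K] K) (T : ColorFun K C →ₗ[K] K)
    (g : C → C → ColorFun K C) :
    T (fun t => L fun x y => g x y t) = L fun x y => T (g x y) := by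
  classical
  have hL (φ : C → C → K) : L φ = ∑ x, ∑ y, L (Pi.single x (Pi.single y 1)) * φ x y := by
    conv_lhs => rw [show φ = ∑ x, ∑ y, φ x y • Pi.single x (Pi.single y (1 : K)) by
      funext a b
      simp [Finset.sum_apply, Pi.single_apply, ite_apply, Finset.sum_ite_eq]]
    simp only [map_sum, map_smul, smul_eq_mul, mul_comm]
  have h : (fun t => L fun x y => g x y t) =
      ∑ x, ∑ y, L (Pi.single x (Pi.single y 1)) • g x y := by
    funext t
    rw [hL]
    simp
  rw [h, hL]
  simp only [map_sum, map_smul, smul_eq_mul]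

namespace DubrovnikModel

variable {z α : K} (M : DubrovnikModel K C z α)

theorem opA_comm (T : Module.End K (ColorFun K C)) : M.opA * T = shift (shift T) * M.opA := by
  refine LinearMap.ext fun f => funext fun s => ?_
  change _ = T (fun t => M.A s.head s.tail.head * f t) s.tail.tail
  exact (congrFun (T.map_smul (M.A s.head s.tail.head) f) s.tail.tail).symm

theorem opU_comm [Fintype C] (T : Module.End K (ColorFun K C)) :
    M.opU * shift (shift T) = T * M.opU := by
  refine LinearMap.ext fun f => funext fun s => ?_
  exact (apply_sum_comm M.U (LinearMap.proj s ∘ₗ T) fun x y t => f (cons x (cons y t))).symm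

theorem opR_comm [Fintype C] (T : Module.End K (ColorFun K C)) :
    M.opR * shift (shift T) = shift (shift T) * M.opR := by
  refine LinearMap.ext fun f => funext fun s => ?_
  exact (apply_sum_comm (LinearMap.proj s.tail.head ∘ₗ LinearMap.proj s.head ∘ₗ M.R)
    (LinearMap.proj s.tail.tail ∘ₗ T) fun x y t => f (cons x (cons y t))).symm

theorem opR'_comm [Fintype C] (T : Module.End K (ColorFun K C)) :
    M.opR' * shift (shift T) = shift (shift T) * M.opR' := by
  rw [opR', add_mul, sub_mul, mul_add, mul_sub, smul_mul_assoc, smul_mul_assoc, mul_assoc,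
    opU_comm, ← mul_assoc, opA_comm, opR_comm, mul_smul_comm, mul_smul_comm, one_mul, mul_one,
    mul_assoc]

/-- The elementary tangles at the leftmost strands. -/
def opGen : TangleGen → Module.End K (ColorFun K C)
  | .cup => M.opU
  | .cap => M.opA
  | .crossOver => M.opR
  | .crossUnder => M.opR'

theorem opGen_comm [Fintype C] (g : TangleGen) (T : Module.End K (ColorFun K C)) :
    M.opGen g * shift^[g.tgt] T = shift^[g.src] T * M.opGen g := by
  cases g
  · exact M.opU_comm T
  · exact M.opA_comm T
  · exact M.opR_comm T
  · exact M.opR'_comm T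

/-- The factors that turn the Dubrovnik version into the Kauffman version of the relations. -/
def weight (ι : K) : TangleGen → ℕ → K
  -- The extrema of a zigzag have positions of opposite parity and total weight 1, whereas a maximum
  -- and a minimum at the same position have total weight -1. This turns `1 - A U` into the `1 + A
  -- U` of the Kauffman version.
  | .cup, i => -(-1) ^ i
  | .cap, i => (-1) ^ i
  | .crossOver, _ => ι
  | .crossUnder, _ => -ι

theorem weight_add_two (ι : K) (g : TangleGen) (i : ℕ) : weight ι g (i + 2) = weight ι g i := by
  cases g <;> simp [weight, pow_add]

/-- The weighted operator of a layer. -/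
def opLayer (ι : K) (l : Layer) : Module.End K (ColorFun K C) :=
  weight ι l.gen l.pos • shift^[l.pos] (M.opGen l.gen)

/-- The operator of a word of layers. -/
def opWord (ι : K) (w : List Layer) : Module.End K (ColorFun K C) := (w.map (M.opLayer ι)).prod

theorem opWord_append (ι : K) (u v : List Layer) :
    M.opWord ι (u ++ v) = M.opWord ι u * M.opWord ι v := by
  simp [opWord]

variable {ι : K}

theorem opWord_two (g h : TangleGen) (i j : ℕ) : M.opWord ι [⟨g, i⟩, ⟨h, i + j⟩] =
    (weight ι g i * weight ι h (i + j)) • shift^[i] (M.opGen g * shift^[j] (M.opGen h)) := by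
  simp only [opWord, opLayer, List.map_cons, List.map_nil, List.prod_cons, List.prod_nil, mul_one,
    smul_mul_smul_comm, shift_iterate_mul, ← Function.iterate_add_apply]

theorem opWord_two' (g h : TangleGen) (i j : ℕ) : M.opWord ι [⟨h, i + j⟩, ⟨g, i⟩] =
    (weight ι g i * weight ι h (i + j)) • shift^[i] (shift^[j] (M.opGen h) * M.opGen g) := by
  simp only [opWord, opLayer, List.map_cons, List.map_nil, List.prod_cons, List.prod_nil, mul_one,
    smul_mul_smul_comm, shift_iterate_mul, ← Function.iterate_add_apply, mul_comm (weight ι g i)]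

theorem opWord_one (g : TangleGen) (i : ℕ) :
    M.opWord ι [⟨g, i⟩] = weight ι g i • shift^[i] (M.opGen g) := by
  simp [opWord, opLayer]

/-- The condition `ι * α = 1` is what the first Reidemeister move demands: the two kinks contribute
`ι α = 1` and `-ι α⁻¹ = -ι² = 1`. -/
theorem opWord_move [Fintype C] (hι : ι ^ 2 = -1) (hα : ι * α = 1) {a b : List Layer}
    (h : LocalMove a b) : M.opWord ι a = M.opWord ι b := by
  have hα0 : α ≠ 0 := right_ne_zero_of_mul_eq_one hα
  have hα' : α⁻¹ = ι := (eq_inv_of_mul_eq_one_left hα).symm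
  have hι' : ι * ι = -1 := by rw [← sq, hι]
  have hs (i : ℕ) : ((-1 : K) ^ i) * (-1) ^ i = 1 := by rw [← mul_pow]; simp
  cases h with
  | exchange g h i k =>
    -- Passing an extremum shifts positions by two, and the weights depend only on parity.
    have e : weight ι h (i + (g.tgt + k)) = weight ι h (i + (g.src + k)) := by
      cases g
      · change weight ι h (i + (2 + k)) = weight ι h (i + (0 + k))
        rw [show i + (2 + k) = i + (0 + k) + 2 by omega, weight_add_two]
      · change weight ι h (i + (0 + k)) = weight ι h (i + (2 + k))
        rw [show i + (2 + k) = i + (0 + k) + 2 by omega, weight_add_two]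
      · rfl
      · rfl
    rw [add_assoc, add_assoc, opWord_two, opWord_two', e, Function.iterate_add_apply, opGen_comm,
      Function.iterate_add_apply]
  | zigzag i =>
    refine (M.opWord_two' .cap .cup i 1).trans ?_
    change (_ * _) • shift^[i] (shift M.opU * M.opA) = 1
    rw [shift_opU_mul_opA, shift_iterate_one]
    simp [weight, pow_succ, hs]
  | zagzig i =>
    refine (M.opWord_two .cup .cap i 1).trans ?_
    change (_ * _) • shift^[i] (M.opU * shift M.opA) = 1
    rw [opU_mul_shift_opA, shift_iterate_one]
    simp [weight, pow_succ, hs]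
  | overCap i =>
    refine (M.opWord_two .crossOver .cap i 1).trans
      (Eq.trans ?_ (M.opWord_two' .cap .crossUnder i 1).symm)
    change (_ * _) • shift^[i] (M.opR * shift M.opA) = (_ * _) • shift^[i] (shift M.opR' * M.opA)
    rw [opR_slide]
    congr 1
    simp only [weight]
    ring
  | underCap i =>
    refine (M.opWord_two .crossUnder .cap i 1).trans
      (Eq.trans ?_ (M.opWord_two' .cap .crossOver i 1).symm)
    change (_ * _) • shift^[i] (M.opR' * shift M.opA) = (_ * _) • shift^[i] (shift M.opR * M.opA)
    rw [opR'_slide]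
    congr 1
    simp only [weight]
    ring
  | cupOver i =>
    refine (M.opWord_two' .crossOver .cup i 1).trans
      (Eq.trans ?_ (M.opWord_two .cup .crossUnder i 1).symm)
    change (_ * _) • shift^[i] (shift M.opU * M.opR) = (_ * _) • shift^[i] (M.opU * shift M.opR')
    rw [slide_opR]
    congr 1
    simp only [weight]
    ring
  | cupUnder i =>
    refine (M.opWord_two' .crossUnder .cup i 1).trans
      (Eq.trans ?_ (M.opWord_two .cup .crossOver i 1).symm)
    change (_ * _) • shift^[i] (shift M.opU * M.opR') = (_ * _) • shift^[i] (M.opU * shift M.opR)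
    rw [slide_opR']
    congr 1
    simp only [weight]
    ring
  | reidemeisterOneOverCap i =>
    refine (M.opWord_two .crossOver .cap i 0).trans (Eq.trans ?_ (M.opWord_one .cap i).symm)
    change (ι * weight ι .cap i) • shift^[i] (M.opR * M.opA) = _ • shift^[i] M.opA
    rw [opR_mul_opA, shift_iterate_smul, smul_smul, mul_right_comm, hα, one_mul]
  | reidemeisterOneUnderCap i =>
    refine (M.opWord_two .crossUnder .cap i 0).trans (Eq.trans ?_ (M.opWord_one .cap i).symm)
    change (-ι * weight ι .cap i) • shift^[i] (M.opR' * M.opA) = _ • shift^[i] M.opA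
    rw [opR'_mul_opA _ hα0, shift_iterate_smul, smul_smul, mul_right_comm, hα', neg_mul, hι',
      neg_neg, one_mul]
  | reidemeisterOneCupOver i =>
    refine (M.opWord_two .cup .crossOver i 0).trans (Eq.trans ?_ (M.opWord_one .cup i).symm)
    change (weight ι .cup i * ι) • shift^[i] (M.opU * M.opR) = _ • shift^[i] M.opU
    rw [opU_mul_opR, shift_iterate_smul, smul_smul, mul_assoc, hα, mul_one]
  | reidemeisterOneCupUnder i =>
    refine (M.opWord_two .cup .crossUnder i 0).trans (Eq.trans ?_ (M.opWord_one .cup i).symm)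
    change (weight ι .cup i * -ι) • shift^[i] (M.opU * M.opR') = _ • shift^[i] M.opU
    rw [opU_mul_opR' _ hα0, shift_iterate_smul, smul_smul, mul_assoc, hα', neg_mul, hι', neg_neg,
      mul_one]
  | reidemeisterTwo i =>
    refine (M.opWord_two .crossOver .crossUnder i 0).trans ?_
    change (ι * -ι) • shift^[i] (M.opR * M.opR') = 1
    rw [opR_mul_opR', mul_neg, hι', neg_neg, one_smul, shift_iterate_one]
  | reidemeisterTwo' i =>
    refine (M.opWord_two .crossUnder .crossOver i 0).trans ?_
    change (-ι * ι) • shift^[i] (M.opR' * M.opR) = 1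
    rw [opR'_mul_opR, neg_mul, hι', neg_neg, one_smul, shift_iterate_one]
  | reidemeisterThree i =>
    have hb := congrArg shift^[i] M.opR_braid
    simp only [shift_iterate_mul] at hb
    simp only [opWord, opLayer, List.map_cons, List.map_nil, List.prod_cons, List.prod_nil, mul_one,
      smul_mul_smul_comm, weight]
    rw [← mul_assoc]
    exact congrArg _ hb

theorem opWord_skein (i : ℕ) :
    M.opWord ι [overAt i] + M.opWord ι [underAt i] =
      (ι * z) • (1 + M.opWord ι [capAt i, cupAt i]) := by
  have hs : (-1 : K) ^ i * -(-1) ^ i = -1 := by rw [mul_neg, ← mul_pow]; simp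
  rw [show M.opWord ι [capAt i, cupAt i] = _ from M.opWord_two .cap .cup i 0, opWord_one,
    opWord_one]
  change ι • shift^[i] M.opR + (-ι) • shift^[i] M.opR' =
    (ι * z) • (1 + ((-1) ^ i * -(-1) ^ i : K) • shift^[i] (M.opA * M.opU))
  simp only [hs, opR', shift_iterate_add, shift_iterate_sub, shift_iterate_smul, shift_iterate_one]
  module

/-- The state sum of a link diagram. -/
def stateSum (ι : K) (s : Stream' C) (D : LinkDiagram) : K := M.opWord ι D.1 (fun _ => 1) s

/-- The state sum as a link invariant. -/
def linkStateSum [Fintype C] (hι : ι ^ 2 = -1) (hα : ι * α = 1) (s : Stream' C) : Link → K :=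
  Quot.lift (M.stateSum ι s) <| by
    rintro D D' ⟨u, a, b, v, hab, hD, hD'⟩
    unfold stateSum
    rw [hD, hD']
    simp only [opWord_append, M.opWord_move hι hα hab]

theorem linkStateSum_toLink [Fintype C] (hι : ι ^ 2 = -1) (hα : ι * α = 1) (s : Stream' C)
    (D : LinkDiagram) : M.linkStateSum hι hα s D.toLink = M.opWord ι D.1 (fun _ => 1) s := rfl

theorem linkStateSum_skein [Fintype C] (hι : ι ^ 2 = -1) (hα : ι * α = 1) (s : Stream' C)
    {Dp Dm D0 Dinf : LinkDiagram} {u v : List Layer} {i : ℕ}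
    (hp : Dp.1 = u ++ [overAt i] ++ v) (hm : Dm.1 = u ++ [underAt i] ++ v)
    (h0 : D0.1 = u ++ v) (hinf : Dinf.1 = u ++ [capAt i, cupAt i] ++ v) :
    M.linkStateSum hι hα s Dp.toLink + M.linkStateSum hι hα s Dm.toLink =
      ι * z * (M.linkStateSum hι hα s D0.toLink + M.linkStateSum hι hα s Dinf.toLink) := by
  have h : M.opWord ι Dp.1 + M.opWord ι Dm.1 =
      (ι * z) • (M.opWord ι D0.1 + M.opWord ι Dinf.1) := by
    rw [hp, hm, h0, hinf]
    simp only [opWord_append]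
    rw [← add_mul, ← mul_add, opWord_skein, mul_smul_comm, smul_mul_assoc, mul_add, mul_one,
      add_mul]
  exact congrFun (LinearMap.congr_fun h fun _ => 1) s

theorem linkStateSum_unknot [Fintype C] (hι : ι ^ 2 = -1) (hα : ι * α = 1) (s : Stream' C) :
    ι * z * M.linkStateSum hι hα s unknot = 2 - ι * z := by
  have e : M.linkStateSum hι hα s unknot = -M.U M.A := by
    change M.opWord ι [cupAt 0, capAt 0] (fun _ => 1) s = _
    rw [show M.opWord ι [cupAt 0, capAt 0] = _ from M.opWord_two .cup .cap 0 0]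
    change weight ι .cup 0 * weight ι .cap 0 * M.U (fun x y => M.A x y * 1) = _
    simp [weight]
  -- With this value `U_A` reads `-ι z U(A) = 2 - ι z`, and the weighted circle is `-U(A)`.
  have hα' : α = -ι := by linear_combination -ι * hα + α * hι
  have hA := M.U_A
  rw [e]
  subst hα'
  linear_combination hA - hι

end DubrovnikModel
end StateSum

/-! ## Uniqueness of the `Q`-polynomial -/

section Uniqueness

open scoped LaurentPolynomial
open LaurentPolynomial (T)

/-- An evaluation of links that satisfies the skein relations and does not vanish on the unknot
separates the possible values of the `Q`-polynomial after specialization. -/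
theorem HasQPolynomial.map_eq {K : Type*} [Field K] (φ : ℤ[T;T⁻¹] →+* K) (ev : Link → K)
    (hev : ∀ (Dp Dm D0 Dinf : LinkDiagram) (u v : List Layer) (i : ℕ),
      Dp.1 = u ++ [overAt i] ++ v → Dm.1 = u ++ [underAt i] ++ v → D0.1 = u ++ v →
      Dinf.1 = u ++ [capAt i, cupAt i] ++ v →
      ev Dp.toLink + ev Dm.toLink = φ (T 1) * (ev D0.toLink + ev Dinf.toLink))
    (hun : ev unknot ≠ 0) {L : Link} {f g : ℤ[T;T⁻¹]} (hf : HasQPolynomial L f)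
    (hg : HasQPolynomial L g) : φ f = φ g := by
  -- Through `φ` the evaluation extends linearly to combinations of links and kills the skein
  -- relators.
  let _ : Module ℤ[T;T⁻¹] K := Module.compHom K φ
  have smul_def (a : ℤ[T;T⁻¹]) (b : K) : a • b = φ a * b := rfl
  have key {f : ℤ[T;T⁻¹]} (hf : HasQPolynomial L f) : ev L = φ f * ev unknot := by
    have hker : Submodule.span ℤ[T;T⁻¹] skeinRelators ≤
        LinearMap.ker (Finsupp.linearCombination ℤ[T;T⁻¹] ev) := by
      rw [Submodule.span_le]
      rintro _ ⟨Dp, Dm, D0, Dinf, u, v, i, hp, hm, h0, hinf, rfl⟩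
      simp only [SetLike.mem_coe, LinearMap.mem_ker, map_sub, map_add, map_smul,
        Finsupp.linearCombination_single, smul_def, map_one, one_mul]
      rw [hev Dp Dm D0 Dinf u v i hp hm h0 hinf, sub_self]
    have h := LinearMap.mem_ker.mp (hker hf)
    simp only [map_sub, Finsupp.linearCombination_single, smul_def, map_one, one_mul] at h
    exact sub_eq_zero.mp h
  exact mul_right_cancel₀ hun ((key hf).symm.trans (key hg))

open Complex in
/-- The points at which the state sums are defined. -/
noncomputable def specialPoint (k : ℕ) : ℂ :=
  I * (exp (Real.pi / (4 * (k + 1)) * I) - (exp (Real.pi / (4 * (k + 1)) * I))⁻¹)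

theorem specialPoint_eq (k : ℕ) :
    specialPoint k = ((-2 * Real.sin (Real.pi / (4 * (k + 1))) : ℝ) : ℂ) := by
  have h := Complex.two_sin (Real.pi / (4 * (k + 1)) : ℂ)
  rw [specialPoint, ← Complex.exp_neg]
  push_cast
  rw [neg_mul, h, neg_mul]
  ring

theorem angle_mem_Ioc (k : ℕ) :
    Real.pi / (4 * (k + 1)) ∈ Set.Ioc 0 (Real.pi / 4) := by
  refine ⟨by positivity, div_le_div_of_nonneg_left Real.pi_pos.le (by norm_num) ?_⟩
  linarith [Nat.cast_nonneg (α := ℝ) k]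

theorem sin_angle_pos (k : ℕ) : 0 < Real.sin (Real.pi / (4 * (k + 1))) :=
  Real.sin_pos_of_pos_of_lt_pi (angle_mem_Ioc k).1
    (by linarith [(angle_mem_Ioc k).2, Real.pi_pos])

theorem specialPoint_injective : Function.Injective specialPoint := by
  intro j k h
  rw [specialPoint_eq, specialPoint_eq, Complex.ofReal_inj] at h
  have hs : Real.sin (Real.pi / (4 * (j + 1))) = Real.sin (Real.pi / (4 * (k + 1))) := by
    linarith
  have hm (i : ℕ) : Real.pi / (4 * (i + 1)) ∈ Set.Icc (-(Real.pi / 2)) (Real.pi / 2) := by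
    have := angle_mem_Ioc i
    constructor <;> linarith [this.1, this.2, Real.pi_pos]
  have he := Real.injOn_sin (hm j) (hm k) hs
  rw [div_eq_div_iff (by positivity) (by positivity)] at he
  have hc := mul_left_cancel₀ Real.pi_ne_zero he
  exact_mod_cast (by linarith : (j : ℝ) = k)

theorem specialPoint_ne_zero (k : ℕ) : specialPoint k ≠ 0 := by
  rw [specialPoint_eq, Complex.ofReal_ne_zero]
  exact (by linarith [sin_angle_pos k] : -2 * Real.sin (Real.pi / (4 * (k + 1))) < 0).ne

open Complex in
theorem exists_evaluation (k : ℕ) :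
    ∃ ev : Link → ℂ, ev unknot ≠ 0 ∧
      ∀ (Dp Dm D0 Dinf : LinkDiagram) (u v : List Layer) (i : ℕ),
        Dp.1 = u ++ [overAt i] ++ v → Dm.1 = u ++ [underAt i] ++ v → D0.1 = u ++ v →
        Dinf.1 = u ++ [capAt i, cupAt i] ++ v →
        ev Dp.toLink + ev Dm.toLink = specialPoint k * (ev D0.toLink + ev Dinf.toLink) := by
  set q : ℂ := exp (Real.pi / (4 * (k + 1)) * I) with hq
  obtain ⟨C, _, ⟨c⟩, ⟨M⟩⟩ := DubrovnikModel.exists_model (exp_ne_zero _ : q ≠ 0) (k + 1)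
  -- The root of unity is chosen so that `k + 1` extensions give `α = I⁻¹`, matching `ι = I`.
  have hqI : q ^ (2 * (k + 1)) = I := by
    rw [hq, ← exp_nat_mul]
    refine Eq.trans (congrArg exp ?_) exp_pi_div_two_mul_I
    have : (k + 1 : ℂ) ≠ 0 := by exact_mod_cast k.succ_ne_zero
    push_cast
    field_simp
    ring
  have hα : I * (q ^ (2 * (k + 1)))⁻¹ = 1 := by rw [hqI, mul_inv_cancel₀ I_ne_zero]
  refine ⟨M.linkStateSum I_sq hα (Stream'.const c), fun h0 => ?_,
    fun Dp Dm D0 Dinf u v i hp hm h0 hinf => M.linkStateSum_skein I_sq hα _ hp hm h0 hinf⟩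
  have h := M.linkStateSum_unknot I_sq hα (Stream'.const c)
  rw [h0, mul_zero] at h
  -- The unknot could only vanish at `x = 2`, but all special points are negative reals.
  have hx : specialPoint k = 2 := (sub_eq_zero.mp h.symm).symm
  rw [specialPoint_eq, ← ofReal_ofNat, ofReal_inj] at hx
  linarith [sin_angle_pos k]

theorem HasQPolynomial.unique {L : Link} {f g : ℤ[T;T⁻¹]} (hf : HasQPolynomial L f)
    (hg : HasQPolynomial L g) : f = g := by
  -- A power of `x` clears the negative exponents; the resulting polynomial has infinitely many
  -- complex roots.
  obtain ⟨n, p, hp⟩ := LaurentPolynomial.exists_T_pow (f - g)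
  have hroot (k : ℕ) : p.eval₂ (Int.castRingHom ℂ) (specialPoint k) = 0 := by
    obtain ⟨ev, hun, hev⟩ := exists_evaluation k
    let x : ℂˣ := Units.mk0 _ (specialPoint_ne_zero k)
    let φ : ℤ[T;T⁻¹] →+* ℂ := LaurentPolynomial.eval₂ (Int.castRingHom ℂ) x
    have hT : φ (T 1) = specialPoint k := by simp [φ, x]
    have h := HasQPolynomial.map_eq φ ev (by simpa only [hT] using hev) hun hf hg
    have h2 := congrArg φ hp
    rw [map_mul, map_sub, h, sub_self, zero_mul] at h2
    simpa [φ, x] using h2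
  have hp0 : p = 0 := by
    have hmap : p.map (Int.castRingHom ℂ) = 0 := by
      refine Polynomial.eq_zero_of_infinite_isRoot _
        ((Set.infinite_range_of_injective specialPoint_injective).mono ?_)
      rintro _ ⟨k, rfl⟩
      simpa [Polynomial.eval_map] using hroot k
    exact (Polynomial.map_eq_zero_iff (RingHom.injective_int _)).mp hmap
  rw [hp0, map_zero] at hp
  exact sub_eq_zero.mp ((LaurentPolynomial.isUnit_T _).mul_left_eq_zero.mp hp.symm)

theorem HasQPolynomial.qPolynomial_eq {L : Link} {f : ℤ[T;T⁻¹]} (hf : HasQPolynomial L f) :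
    qPolynomial L = f := by
  have h : ∃! f : ℤ[T;T⁻¹], HasQPolynomial L f := ⟨f, hf, fun _ hg => hg.unique hf⟩
  rw [qPolynomial, dif_pos h]
  exact h.choose_spec.1.unique hf

end Uniqueness

theorem mainTheorem6 (p q : ℤ) :
    ∃ f : Polynomial ℤ,
      qPolynomial (kanenobuKnot p q) = Polynomial.toLaurent f ∧
      f.natDegree =
        if 0 ≤ p * q then p.natAbs + q.natAbs + 6 else p.natAbs + q.natAbs + 5 := by
  refine ⟨kanenobuPoly p q + 1, (hasQPolynomial_kanenobuKnot p q).qPolynomial_eq, ?_⟩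
  rw [← Polynomial.C_1, Polynomial.natDegree_add_C, natDegree_kanenobuPoly]
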